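/- **Notation.** For a positive integer $N$ let $\nu(N)$ be the number of prime factors of $N$ counted with multiplicity, $\varphi$ Euler's function and $\psi(N)=\prod_{p\mid N}(p+1)$. Write $B_2(t)=\langle t\rangle^2-\langle t\rangle+\frac16$, with $\langle t\rangle$ the fractional part of $t$. For $\gamma=\begin{pmatrix}a&b\\c&d\end{pmatrix}\in \mathrm{GL}_2^+(\mathbb R)$ and a function $g$ on the upper half plane $\mathcal H$, let $(g|\gamma)(z)=\det(\gamma)(cz+d)^{-2}g\!\left(\frac{az+b}{cz+d}\right)$. For $\underline x=(x_1,x_2)\in(\mathbb Q/\mathbb Z)^2$ let $\phi_{\underline x}$ be Hecke's weight two function on $\mathcal H$, given by $$\phi_{\underline x}(z)+\delta(\underline x)\frac{i}{2\pi(z-\bar z)}=\tfrac12B_2(x_1)-P_{\underline x}(z)-P_{-\underline x}(z),\qquad P_{\underline x}(z)=\sum_{k\in\mathbb Q_{>0},\,k\equiv x_1 (1)}k\sum_{m\ge1}e^{2\pi i m(kz+x_2)},$$ with $\delta(\underline x)=1$ if $\underline x=0$ and $0$ otherwise. Let $D$ be a positive square-free integer and $C\ge1$ a divisor of $D$. Let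 $\mathcal H(DC)$ be the set of triples $(M,L,\chi)$ with $M,L$ positive divisors of $D$, $M\ne1$, $D\mid ML\mid DC$, and $\chi$ a primitive Dirichlet character of conductor $f=f_\chi$ dividing $(M,L)$; put $\chi(n)=0$ when $(n,f)\neq1$. Let $g(\chi)=\sum_{a\in\mathbb Z/f}\chi(a)e^{2\pi i a/f}$ and $$E_\chi=-\frac1{2g(\chi)}\sum_{a\in(\mathbb Z/f)^\times}\ \sum_{b\in(\mathbb Z/f^2)^\times}\chi(a)\chi(b)\,\phi_{(\frac af,\frac b{f^2})}.$$ For a prime $p\nmid f$ put $\gamma_p=\begin{pmatrix}p&0\\0&1\end{pmatrix}$, $[p]^+_\chi(g)=g-\chi(p)\,g|\gamma_p$ and $[p]^-_\chi(g)=g-p^{-1}\chi^{-1}(p)\,g|\gamma_p$; for square-free $K$ prime to $f$ let $[K]^\pm_\chi$ be the composition of the commuting operators $[p]^\pm_\chi$ over the primes $p\mid K$. Define $E_{M,L,\chi}=[L/f]^-_\chi\circ[M/f]^+_\chi(E_\chi)$. Every cusp of $X_0(DC)$ is of the form $\left[\frac{rs^2tx}{DC}\right]$ with positive integers $r\mid\frac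 DC$ and $s,t\mid C$, $(s,t)=1$, and an integer $x$ prime to $D$. For a cusp $[q]$ of $X_0(DC)$, $a_0(g;[q])$ denotes the constant term of the Fourier expansion of $g|\gamma$ in powers of $e^{2\pi i z/h}$ (for some integer $h\geq 1$), for any $\gamma\in \mathrm{SL}_2(\mathbb Z)$ with $\gamma\infty$ in the $\Gamma_0(DC)$-orbit of $q$. **Proposition 4.6.** Let $(M,L,\chi)\in\mathcal H(DC)$ with $\chi^2=1$, and let $f$ be the conductor of $\chi$. For any $r,s,t,x$ as above, $E_{M,L,\chi}$ has a Fourier expansion at the cusp $\left[\frac{rs^2tx}{DC}\right]$ of $X_0(DC)$, and its constant term does not depend on the choice of $\gamma$ and is $$a_0\!\left(E_{M,L,\chi};\left[\tfrac{rs^2tx}{DC}\right]\right)=\begin{cases}n_\chi\cdot\varphi\!\left(\frac Df\right)\psi\!\left(\frac Lf\right)\cdot\frac fL\cdot c_\chi\!\left[\frac{rs^2tx}{DC}\right]&\text{if }(s,f)=1,\ (M,L)\mid st\text{ and }\frac DM\mid rs,\\[1mm]0&\text{otherwise,}\end{cases}$$ where $$n_\chi=-\frac{f}{4g(\chi)}\sum_{a,b\in\mathbb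 Z/f}\chi(a)\chi(b)B_2\!\left(\tfrac{a+b}{f}\right)$$ and, in the first case, $$c_\chi\!\left[\tfrac{rs^2tx}{DC}\right]=(-1)^{\nu\left(\frac D{frs}\right)}\cdot\chi\!\left(\tfrac{DC}{frs^2tx}\right)\cdot(rs)^{-1}\cdot\prod_{p\mid(s,M,L)}\left(1-\tfrac1p\right),$$ with $\chi(u/x)=\chi(u)\chi(x)^{-1}$. -/

import Mathlib

open UpperHalfPlane OnePoint
open scoped MatrixGroups ModularForm

namespace EisConst

noncomputable section

/-- The periodic second Bernoulli function `B₂(t) = ⟨t⟩² - ⟨t⟩ + 1/6`, where `⟨t⟩` is the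
fractional part of `t`. -/
def B2 (t : ℚ) : ℚ := Int.fract t ^ 2 - Int.fract t + 1 / 6

/-- `P_x(z) = ∑_{k ∈ ℚ, k > 0, k ≡ x₁ mod 1} k ∑_{m ≥ 1} exp(2πi m (k z + x₂))`
for `x = (x₁, x₂)`. -/
def P (x₁ x₂ : ℚ) (z : ℍ) : ℂ :=
  ∑' k : {k : ℚ // 0 < k ∧ ∃ n : ℤ, k = x₁ + n}, (k.1 : ℂ) *
    ∑' m : ℕ+, Complex.exp (2 * Real.pi * Complex.I * (m : ℂ) * ((k.1 : ℂ) * (z : ℂ) + (x₂ : ℂ)))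

/-- Hecke's weight two functions `φ_x` on the upper half plane, for `x = (x₁, x₂)` a pair of
rationals (the value only depends on `x` modulo `ℤ²`), given by
`φ_x(z) + δ(x) i / (2π (z - z̄)) = B₂(x₁) / 2 - P_x(z) - P_{-x}(z)`,
where `δ(x)` is `1` if `x ∈ ℤ²` and `0` otherwise. -/
def heckePhi (x₁ x₂ : ℚ) (z : ℍ) : ℂ :=
  (B2 x₁ : ℂ) / 2 - P x₁ x₂ z - P (-x₁) (-x₂) z -
    (if Int.fract x₁ = 0 ∧ Int.fract x₂ = 0 then
      Complex.I / (2 * Real.pi * ((z : ℂ) - (starRingEnd ℂ) (z : ℂ))) else 0)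

/-- The matrix `γ_p = (p 0; 0 1)` in `GL₂⁺(ℝ)`, for a positive integer `p`
(by convention the identity for `p = 0`, which is never used). -/
def gammaMat (p : ℕ) : GL (Fin 2) ℝ :=
  if h : p = 0 then 1
  else Matrix.GeneralLinearGroup.mkOfDetNeZero !![(p : ℝ), 0; 0, 1] (by simp [h])

variable {f : ℕ}

/-- `[p]⁺_χ = 1 - χ(p) γ_p`, where `γ_p` acts by the weight two slash operator. -/
def opPlus (χ : DirichletCharacter ℂ f) (p : ℕ) (g : ℍ → ℂ) : ℍ → ℂ :=
  g - χ (p : ZMod f) • (g ∣[(2 : ℤ)] gammaMat p)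

/-- `[p]⁻_χ = 1 - p⁻¹ χ⁻¹(p) γ_p`, where `γ_p` acts by the weight two slash operator. -/
def opMinus (χ : DirichletCharacter ℂ f) (p : ℕ) (g : ℍ → ℂ) : ℍ → ℂ :=
  g - ((p : ℂ)⁻¹ * χ⁻¹ (p : ZMod f)) • (g ∣[(2 : ℤ)] gammaMat p)

/-- `[K]⁺_χ` for squarefree `K`: the composition of the (commuting) operators `[p]⁺_χ` over the
primes `p` dividing `K`. -/
def OpPlus (χ : DirichletCharacter ℂ f) (K : ℕ) (g : ℍ → ℂ) : ℍ → ℂ :=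
  K.primeFactorsList.foldr (opPlus χ) g

/-- `[K]⁻_χ` for squarefree `K`: the composition of the (commuting) operators `[p]⁻_χ` over the
primes `p` dividing `K`. -/
def OpMinus (χ : DirichletCharacter ℂ f) (K : ℕ) (g : ℍ → ℂ) : ℍ → ℂ :=
  K.primeFactorsList.foldr (opMinus χ) g

/-- The Gauss sum `g(χ) = ∑_{a mod f} χ(a) exp(2πi a / f)`. -/
def gauss [NeZero f] (χ : DirichletCharacter ℂ f) : ℂ := gaussSum χ ZMod.stdAddChar

/-- `E_χ = -1/(2 g(χ)) ∑_{a ∈ (ℤ/f)ˣ} ∑_{b ∈ (ℤ/f²)ˣ} χ(a) χ(b) φ_{(a/f, b/f²)}`,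
for `χ` primitive of conductor `f`. -/
def Echi [NeZero f] (χ : DirichletCharacter ℂ f) : ℍ → ℂ := fun z ↦
  -(1 / (2 * gauss χ)) * ∑ a : (ZMod f)ˣ, ∑ b : (ZMod (f ^ 2))ˣ,
    χ (a : ZMod f) * χ ((b : ZMod (f ^ 2)).val : ZMod f) *
      heckePhi (((a : ZMod f).val : ℚ) / f) (((b : ZMod (f ^ 2)).val : ℚ) / (f : ℚ) ^ 2) z

/-- `E_{M,L,χ} = [L/f]⁻_χ ∘ [M/f]⁺_χ (E_χ)`. -/
def EMLchi [NeZero f] (M L : ℕ) (χ : DirichletCharacter ℂ f) : ℍ → ℂ :=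
  OpMinus χ (L / f) (OpPlus χ (M / f) (Echi χ))

/-- `(M, L, χ)` belongs to the set `H(DC)`; a Dirichlet character is represented by the primitive
character `χ` modulo its conductor `f`. -/
structure MemH (D C M L : ℕ) (χ : DirichletCharacter ℂ f) : Prop where
  M_dvd : M ∣ D
  L_dvd : L ∣ D
  M_ne_one : M ≠ 1
  D_dvd : D ∣ M * L
  dvd_DC : M * L ∣ D * C
  primitive : χ.IsPrimitive
  cond_dvd : f ∣ Nat.gcd M L

/-- `n_χ = -f/(4 g(χ)) ∑_{a, b ∈ ℤ/f} χ(a) χ(b) B₂((a + b)/f)`. -/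
def nchi [NeZero f] (χ : DirichletCharacter ℂ f) : ℂ :=
  -((f : ℂ) / (4 * gauss χ)) * ∑ a : ZMod f, ∑ b : ZMod f,
    χ a * χ b * ((B2 (((a.val : ℚ) + (b.val : ℚ)) / f) : ℚ) : ℂ)

/-- `ψ(N) = ∏_{p ∣ N} (p + 1)`. -/
def psi (N : ℕ) : ℕ := ∏ p ∈ N.primeFactors, (p + 1)

/-- `c_χ[rs²tx/(DC)] = (-1)^{ν(D/(f r s))} χ(DC/(f r s² t x)) (rs)⁻¹ ∏_{p ∣ (s, M, L)} (1 - 1/p)`,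
where `ν` counts prime factors with multiplicity and `χ(u/x) = χ(u) χ(x)⁻¹`. It is only used where
`f r s ∣ D`, and `f r s² t ∣ DC`, so that the quotients of naturals are exact. -/
def cchi (D C M L : ℕ) (χ : DirichletCharacter ℂ f) (r s t : ℕ) (x : ℤ) : ℂ :=
  (-1) ^ (ArithmeticFunction.cardFactors (D / (f * r * s))) *
    (χ ((D * C / (f * r * s ^ 2 * t) : ℕ) : ZMod f) * (χ (x : ZMod f))⁻¹) *
    ((r : ℂ) * (s : ℂ))⁻¹ *
    ∏ p ∈ (Nat.gcd s (Nat.gcd M L)).primeFactors, (1 - 1 / (p : ℂ))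

/-- `a₀(g; [q]) = a₀`: the Fourier expansion of `g` at the cusp of `X₀(N)` represented by the
rational number `q` exists and has constant term `a₀`. That is, for every `γ ∈ SL₂(ℤ)` sending
`∞` to a point in the `Γ₀(N)`-orbit of `q`, the function `g|γ` (weight two) is the sum of a power
series in `exp(2πi z / h)`, for some positive integer `h`, with constant coefficient `a₀`. -/
def HasConstantTermAt (N : ℕ) (g : ℍ → ℂ) (q : ℚ) (a₀ : ℂ) : Prop :=
  ∀ γ : SL(2, ℤ),
    (∃ δ ∈ CongruenceSubgroup.Gamma0 N,
      (Matrix.SpecialLinearGroup.mapGL ℚ (δ * γ)) • (∞ : OnePoint ℚ) = ((q : ℚ) : OnePoint ℚ)) →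
    ∃ h : ℕ, 0 < h ∧ ∃ a : ℕ → ℂ, a 0 = a₀ ∧ ∀ z : ℍ,
      HasSum (fun n : ℕ ↦ a n * Complex.exp (2 * Real.pi * Complex.I * (n : ℂ) * (z : ℂ) / (h : ℂ)))
        ((g ∣[(2 : ℤ)] γ) z)

end

end EisConst

/-!
The key observation is that for a primitive quadratic character `χ` of conductor `f` the function
`E_χ` is the twist by `χ` of the completed Eisenstein series of level one (`Echi_eq_sum_slash`):
with `E₂*(z) = E₂(z) - 3 / (π Im z)`,
`E_χ(z) = -1 / (24 g(χ)) ∑_b χ(b) E₂*(z + b / f)`,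
the sum being over `b` modulo `f`. Both sides have the `q`-expansion
`∑_{j, m ≥ 1} j χ(j) χ(m) q^{jm}`, up to a constant and a nonholomorphic term that occur only for
`f = 1`. Hence the only modularity needed is the invariance of `E₂*` under `SL₂(ℤ)`, and no
transformation law for the functions `φ_x` enters.

Consequently `E_{M,L,χ}` is a combination of functions `E₂*|A` with `A` an integral matrix of
positive determinant. Writing an integral matrix `B` as an element of `SL₂(ℤ)` times an upper
triangular matrix, the constant term of `E₂*|B` is `(u, w)² / det B`, where `(u, w)` is the
greatest common divisor of the first column of `B` (`hasCuspValues_E2star`). The predicate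
`HasCuspValues` records this information, and is stable under linear combinations and under the
slash action. The multiple of `1 / Im z` is the same for all `B`, and cancels in `E_{M,L,χ}` because
`M ≠ 1`.

The constant term of `E_χ` at a primitive vector is then a sum `∑_b χ(b) (f u + b w, f w)²`. By
primitivity of `χ` (`sum_char_mul_affine`) it equals `f² χ(u) χ(w / f)`, or zero when `f ∤ w`,
times the universal sum `∑_b χ(b) (1 + b, f)²`. The distribution relation for `B₂` identifies that same
sum with `n_χ` (`nchi_eq`), so neither it nor the Gauss sum has to be evaluated. Replacing `u` by
`K u` for `K` prime to `f` multiplies the value by `χ(K) (K, w)²`, which is an Euler product; each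
operator `[p]⁺` and `[p]⁻` therefore acts on the factor at `p` alone
(`HasEulerProduct.foldr`), and the result at a primitive vector is a product of explicit local
factors (`exists_hasCuspValues_EMLchi`).

For the cusp `r s² t x / (D C)`, write `D = s t v r r'` with `C = s t v`. The reduced denominator
is `r' t v²`, and moving inside the `Γ₀(D C)`-orbit changes neither its divisibility by divisors of
`D C` nor the value of the character. So the local factor at `p` depends only on whether `p`
divides `M`, `L`, `r s` and `s t`; it vanishes exactly as the case distinction of the theorem says,
and otherwise the factors multiply up to the stated constant (`prod_localFactor`).
-/

namespace EisConst

noncomputable section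

/-! ### Power series at the cusps and the completed Eisenstein series of level one -/

/-- `φ` is the sum of a power series in `exp(2πi z / h)`, for some positive integer `h`, with
constant coefficient `c`. -/
def IsQSeries (φ : ℍ → ℂ) (c : ℂ) : Prop :=
  ∃ h : ℕ, 0 < h ∧ ∃ a : ℕ → ℂ, a 0 = c ∧ ∀ z : ℍ,
    HasSum (fun n : ℕ ↦ a n * Complex.exp (2 * Real.pi * Complex.I * (n : ℂ) * (z : ℂ) / (h : ℂ)))
      (φ z)

/-- The substitution `z ↦ (α z + β) / δ` turns a power series in `exp(2πi z / h)` into one in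
`exp(2πi z / (δ h))`. With `α = δ` and `β = 0` this refines the parameter. -/
lemma exists_coeff_comp_affine {a : ℕ → ℂ} {h α δ : ℕ} (hh : 0 < h) (hα : 0 < α) (hδ : 0 < δ)
    (β : ℤ) : ∃ b : ℕ → ℂ, b 0 = a 0 ∧ ∀ z w s : ℂ, w = (α * z + β) / δ →
      HasSum (fun n : ℕ ↦ a n * Complex.exp (2 * Real.pi * Complex.I * n * w / h)) s →
      HasSum (fun n : ℕ ↦ b n *
        Complex.exp (2 * Real.pi * Complex.I * n * z / ((δ * h : ℕ) : ℂ))) s := by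
  have hinj : Function.Injective (fun n : ℕ ↦ α * n) := fun m n hmn ↦
    Nat.eq_of_mul_eq_mul_left hα hmn
  refine ⟨Function.extend (fun n : ℕ ↦ α * n)
    (fun n ↦ a n * Complex.exp (2 * Real.pi * Complex.I * n * β / ((δ * h : ℕ) : ℂ))) 0, ?_, ?_⟩
  · have := hinj.extend_apply
      (fun n ↦ a n * Complex.exp (2 * Real.pi * Complex.I * n * β / ((δ * h : ℕ) : ℂ))) 0 0
    simpa using this
  · rintro z w s rfl hs
    rw [← hinj.hasSum_iff]
    · convert hs using 2 with n
      simp only [Function.comp_apply, hinj.extend_apply, mul_assoc, ← Complex.exp_add]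
      congr 2
      have : (h : ℂ) ≠ 0 := by exact_mod_cast hh.ne'
      have : (δ : ℂ) ≠ 0 := by exact_mod_cast hδ.ne'
      push_cast
      field_simp
      ring
    · intro n hn
      rw [Function.extend_apply' _ _ _ (by simpa using hn)]
      simp

lemma IsQSeries.comp_affine {φ ψ : ℍ → ℂ} {c : ℂ} (hφ : IsQSeries φ c) {α δ : ℕ} (hα : 0 < α)
    (hδ : 0 < δ) (β : ℤ)
    (hψ : ∀ z : ℍ, ∃ w : ℍ, (w : ℂ) = (α * (z : ℂ) + β) / δ ∧ ψ z = φ w) : IsQSeries ψ c := by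
  obtain ⟨h, hh, a, rfl, ha⟩ := hφ
  obtain ⟨b, hb, hs⟩ := exists_coeff_comp_affine (a := a) hh hα hδ β
  refine ⟨δ * h, by positivity, b, hb, fun z ↦ ?_⟩
  obtain ⟨w, hw, e⟩ := hψ z
  rw [e]
  exact hs z w _ hw (ha w)

lemma IsQSeries.smul {φ : ℍ → ℂ} {c : ℂ} (hφ : IsQSeries φ c) (k : ℂ) :
    IsQSeries (fun z ↦ k * φ z) (k * c) := by
  obtain ⟨h, hh, a, rfl, ha⟩ := hφ
  exact ⟨h, hh, fun n ↦ k * a n, rfl, fun z ↦ by simpa [mul_assoc] using (ha z).mul_left k⟩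

lemma isQSeries_zero : IsQSeries (fun _ ↦ 0) 0 :=
  ⟨1, one_pos, 0, rfl, fun z ↦ by simp [hasSum_zero]⟩

lemma IsQSeries.add {φ ψ : ℍ → ℂ} {c d : ℂ} (hφ : IsQSeries φ c) (hψ : IsQSeries ψ d) :
    IsQSeries (fun z ↦ φ z + ψ z) (c + d) := by
  obtain ⟨h, hh, a, rfl, ha⟩ := hφ
  obtain ⟨k, hk, b, rfl, hb⟩ := hψ
  obtain ⟨a', ha', hsa⟩ := exists_coeff_comp_affine (a := a) hh hk hk 0
  obtain ⟨b', hb', hsb⟩ := exists_coeff_comp_affine (a := b) hk hh hh 0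
  have hk' : (k : ℂ) ≠ 0 := by exact_mod_cast hk.ne'
  have hh' : (h : ℂ) ≠ 0 := by exact_mod_cast hh.ne'
  refine ⟨k * h, by positivity, fun n ↦ a' n + b' n, by simp [ha', hb'], fun z ↦ ?_⟩
  have h1 := hsa z z _ (by push_cast; field_simp; ring) (ha z)
  have h2 := hsb z z _ (by push_cast; field_simp; ring) (hb z)
  rw [mul_comm h k] at h2
  simpa [add_mul] using h1.add h2

/-- `g` behaves at every cusp like a modular form of weight two up to a multiple of `1 / Im z`:
for every integral matrix `B` of positive determinant with first column `(u, w)`, the function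
`g|B - κ / Im z` is a `q`-series, with constant term `F u w / det B`.
The factor `κ` is the same for all `B` because upper triangular matrices fix `1 / Im z`. -/
def HasCuspValues (g : ℍ → ℂ) (κ : ℂ) (F : ℤ → ℤ → ℂ) : Prop :=
  ∀ (A : GL (Fin 2) ℝ) (B : Matrix (Fin 2) (Fin 2) ℤ), A.val = B.map (Int.cast : ℤ → ℝ) →
    0 < B.det → IsQSeries (fun z ↦ (g ∣[(2 : ℤ)] A) z - κ / (z.im : ℂ)) (F (B 0 0) (B 1 0) / B.det)

lemma det_pos_of_eq_map {A : GL (Fin 2) ℝ} {B : Matrix (Fin 2) (Fin 2) ℤ}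
    (hA : A.val = B.map (Int.cast : ℤ → ℝ)) (hB : 0 < B.det) : 0 < A.det.val := by
  have : A.det.val = (B.det : ℝ) := by
    rw [Matrix.GeneralLinearGroup.val_det_apply, hA]
    exact (Int.cast_det B).symm
  rw [this]
  exact_mod_cast hB

lemma smul_slash_of_det_pos {A : GL (Fin 2) ℝ} (hA : 0 < A.det.val) (g : ℍ → ℂ) (c : ℂ) :
    (c • g) ∣[(2 : ℤ)] A = c • (g ∣[(2 : ℤ)] A) := by
  rw [ModularForm.smul_slash, UpperHalfPlane.σ, if_pos (by simpa using hA)]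
  rfl

lemma HasCuspValues.add {g g' : ℍ → ℂ} {κ κ' : ℂ} {F F' : ℤ → ℤ → ℂ} (h : HasCuspValues g κ F)
    (h' : HasCuspValues g' κ' F') :
    HasCuspValues (g + g') (κ + κ') (fun u w ↦ F u w + F' u w) := by
  intro A B hA hB
  convert (h A B hA hB).add (h' A B hA hB) using 1
  · ext z
    rw [SlashAction.add_slash, Pi.add_apply]
    ring
  · ring

lemma HasCuspValues.smul {g : ℍ → ℂ} {κ : ℂ} {F : ℤ → ℤ → ℂ} (h : HasCuspValues g κ F) (c : ℂ) :
    HasCuspValues (c • g) (c * κ) (fun u w ↦ c * F u w) := by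
  intro A B hA hB
  convert (h A B hA hB).smul c using 1
  · ext z
    rw [smul_slash_of_det_pos (det_pos_of_eq_map hA hB), Pi.smul_apply, smul_eq_mul]
    ring
  · ring

lemma HasCuspValues.sub_smul {g g' : ℍ → ℂ} {κ κ' : ℂ} {F F' : ℤ → ℤ → ℂ}
    (h : HasCuspValues g κ F) (h' : HasCuspValues g' κ' F') (c : ℂ) :
    HasCuspValues (g - c • g') (κ - c * κ') (fun u w ↦ F u w - c * F' u w) := by
  convert h.add (h'.smul (-c)) using 1
  · ext z
    simp [sub_eq_add_neg]
  · ring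
  · ext u w
    ring

lemma HasCuspValues.sum {ι : Type*} (s : Finset ι) {g : ι → ℍ → ℂ} {κ : ι → ℂ}
    {F : ι → ℤ → ℤ → ℂ} (h : ∀ i ∈ s, HasCuspValues (g i) (κ i) (F i)) :
    HasCuspValues (∑ i ∈ s, g i) (∑ i ∈ s, κ i) (fun u w ↦ ∑ i ∈ s, F i u w) := by
  classical
  induction s using Finset.induction_on with
  | empty =>
    intro A B _ _
    simp [isQSeries_zero]
  | insert i s hi ih =>
    simp only [Finset.sum_insert hi]
    exact (h i (Finset.mem_insert_self i s)).add
      (ih fun j hj ↦ h j (Finset.mem_insert_of_mem hj))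

lemma HasCuspValues.slash {g : ℍ → ℂ} {κ : ℂ} {F : ℤ → ℤ → ℂ} (h : HasCuspValues g κ F)
    {A : GL (Fin 2) ℝ} {B : Matrix (Fin 2) (Fin 2) ℤ} (hA : A.val = B.map (Int.cast : ℤ → ℝ))
    (hB : 0 < B.det) :
    HasCuspValues (g ∣[(2 : ℤ)] A) κ
      (fun u w ↦ F (B 0 0 * u + B 0 1 * w) (B 1 0 * u + B 1 1 * w) / B.det) := by
  intro A' B' hA' hB'
  have := h (A * A') (B * B') (by
    rw [Units.val_mul, hA, hA']
    exact (Matrix.map_mul (f := Int.castRingHom ℝ)).symm) (by rw [Matrix.det_mul]; positivity)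
  rw [Matrix.det_mul, SlashAction.slash_mul] at this
  simpa [Matrix.mul_apply, Fin.sum_univ_two, div_div] using this

/-- The weight two Eisenstein series of level one, completed by the multiple of `1 / Im z` that
makes it invariant under `SL₂(ℤ)`. -/
def E2star (z : ℍ) : ℂ := EisensteinSeries.E2 z - 3 / (Real.pi * z.im)

lemma E2star_slash (γ : SL(2, ℤ)) : E2star ∣[(2 : ℤ)] γ = E2star := by
  ext z
  have h := congrFun (EisensteinSeries.E2_slash_action γ) z
  rw [ModularForm.SL_slash_apply] at h ⊢
  simp only [E2star, sub_mul, h, Pi.sub_apply, Pi.smul_apply, EisensteinSeries.D2, smul_eq_mul,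
    riemannZeta_two]
  have hd : denom γ z ≠ 0 := denom_ne_zero γ z
  have him : ((γ • z).im : ℂ) = z.im / (denom γ z * (starRingEnd ℂ) (denom γ z)) := by
    rw [ModularGroup.im_smul_eq_div_normSq, Complex.mul_conj]
    push_cast
    rfl
  have hconj : (starRingEnd ℂ) (denom γ z) = denom γ z - 2 * Complex.I * (γ 1 0) * z.im := by
    rw [ModularGroup.denom_apply]
    apply Complex.ext
    · simp
    · simp
      ring
  have hy : (z.im : ℂ) ≠ 0 := by exact_mod_cast z.im_pos.ne'
  have hpi : (Real.pi : ℂ) ≠ 0 := by exact_mod_cast Real.pi_ne_zero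
  have hd' : (starRingEnd ℂ) (denom γ z) ≠ 0 := by simp [hd]
  rw [him, zpow_neg, zpow_ofNat]
  have e : (3 : ℂ) / (Real.pi * (z.im / (denom γ z * (starRingEnd ℂ) (denom γ z)))) =
      3 * denom γ z * (starRingEnd ℂ) (denom γ z) / (Real.pi * z.im) := by
    field_simp
  rw [e, hconj]
  field_simp
  ring

lemma isQSeries_E2 : IsQSeries EisensteinSeries.E2 1 := by
  refine ⟨1, one_pos, fun n ↦ if n = 0 then 1 else -24 * ArithmeticFunction.sigma 1 n, by simp,
    fun z ↦ ?_⟩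
  convert EisensteinSeries.hasSum_qExpansion_E2 (z := z) using 2 with n
  rw [smul_eq_mul, ← Complex.exp_nat_mul]
  congr 2
  push_cast
  ring

/-- Every integral vector is a multiple of the first column of a matrix in `SL₂(ℤ)`, so an integral
matrix of positive determinant is the product of such a matrix and an upper triangular one. -/
lemma exists_SL_mul_upper (B : Matrix (Fin 2) (Fin 2) ℤ) (hB : 0 < B.det) :
    ∃ (γ : SL(2, ℤ)) (β : ℤ) (δ : ℕ), 0 < δ ∧ 0 < Int.gcd (B 0 0) (B 1 0) ∧
      B = γ.val * !![(Int.gcd (B 0 0) (B 1 0) : ℤ), β; 0, (δ : ℤ)] := by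
  rw [Matrix.det_fin_two] at hB
  set u := B 0 0 with hu
  set w := B 1 0 with hw
  have hg : 0 < Int.gcd u w := by
    rw [Int.gcd_pos_iff]
    by_contra! hcon
    simp [hcon] at hB
  set g : ℕ := Int.gcd u w
  obtain ⟨u', hu'⟩ := Int.gcd_dvd_left u w
  obtain ⟨w', hw'⟩ := Int.gcd_dvd_right u w
  have hbez := Int.gcd_eq_gcd_ab u w
  set m := Int.gcdA u w
  set n := Int.gcdB u w
  have hg' : (g : ℤ) ≠ 0 := by exact_mod_cast hg.ne'
  have hone : u' * m + w' * n = 1 := by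
    apply mul_left_cancel₀ hg'
    linear_combination (-m) * hu' - n * hw' - hbez
  have hδ : 0 < u' * B 1 1 - w' * B 0 1 := by
    have : 0 < (g : ℤ) * (u' * B 1 1 - w' * B 0 1) := by
      convert hB using 1
      linear_combination (-B 1 1) * hu' + B 0 1 * hw'
    exact (mul_pos_iff_of_pos_left (by exact_mod_cast hg)).mp this
  refine ⟨⟨!![u', -n; w', m], by rw [Matrix.det_fin_two]; simp; linarith⟩,
    m * B 0 1 + n * B 1 1, (u' * B 1 1 - w' * B 0 1).toNat, by omega, hg, ?_⟩
  rw [Int.toNat_of_nonneg hδ.le]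
  ext i j
  fin_cases i <;> fin_cases j <;> simp [Matrix.mul_apply, Fin.sum_univ_two]
  · linarith
  · linear_combination (-B 0 1) * hone
  · linarith
  · linear_combination (-B 1 1) * hone

lemma hasCuspValues_E2star :
    HasCuspValues E2star (-3 / Real.pi) (fun u w ↦ (Int.gcd u w : ℂ) ^ 2) := by
  intro A B hA hB
  obtain ⟨γ, β, δ, hδ, hg, hBγ⟩ := exists_SL_mul_upper B hB
  set g := Int.gcd (B 0 0) (B 1 0)
  have hdet : B.det = g * δ := by
    rw [hBγ, Matrix.det_mul, γ.det_coe, Matrix.det_fin_two]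
    simp
  have hT : (!![(g : ℝ), (β : ℝ); 0, (δ : ℝ)]).det ≠ 0 := by
    rw [Matrix.det_fin_two]
    have : (0 : ℝ) < g := by exact_mod_cast hg
    have : (0 : ℝ) < δ := by exact_mod_cast hδ
    simp
    constructor <;> positivity
  set T : GL (Fin 2) ℝ := Matrix.GeneralLinearGroup.mkOfDetNeZero _ hT with hTdef
  have hAT : A = (γ : GL (Fin 2) ℝ) * T := by
    apply Units.ext
    rw [hA, hBγ]
    ext i j
    fin_cases i <;> fin_cases j <;>
      simp [hTdef, Matrix.GeneralLinearGroup.mkOfDetNeZero, Matrix.mul_apply, Fin.sum_univ_two]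
  have hgδ : (0 : ℝ) < g * δ := by positivity
  have hTdet : T.det.val = g * δ := by
    rw [Matrix.GeneralLinearGroup.val_det_apply, hTdef]
    simp [Matrix.GeneralLinearGroup.mkOfDetNeZero, Matrix.det_fin_two]
  have hTd (z : ℍ) : denom T z = δ := by
    simp [denom, hTdef, Matrix.GeneralLinearGroup.mkOfDetNeZero]
  have hTz (z : ℍ) : ((T • z : ℍ) : ℂ) = (g * (z : ℂ) + β) / δ := by
    rw [UpperHalfPlane.coe_smul_of_det_pos (by rw [hTdet]; exact hgδ)]
    simp [num, denom, hTdef, Matrix.GeneralLinearGroup.mkOfDetNeZero]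
  have hδ' : (δ : ℂ) ≠ 0 := by exact_mod_cast hδ.ne'
  have hg' : (g : ℂ) ≠ 0 := by exact_mod_cast hg.ne'
  have hpi : (Real.pi : ℂ) ≠ 0 := by exact_mod_cast Real.pi_ne_zero
  have hTim (z : ℍ) : ((T • z).im : ℂ) = g * z.im / δ := by
    have : (T • z).im = g * z.im / δ := by
      rw [← UpperHalfPlane.coe_im, hTz]
      rw [show ((δ : ℂ)) = ((δ : ℝ) : ℂ) by simp, Complex.div_ofReal_im]
      simp
    rw [this]
    push_cast
    rfl
  have hslash (z : ℍ) : (E2star ∣[(2 : ℤ)] A) z = (g / δ) * E2star (T • z) := by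
    rw [hAT, SlashAction.slash_mul, ← ModularForm.SL_slash, E2star_slash, ModularForm.slash_apply,
      UpperHalfPlane.σ, if_pos (hTdet.symm ▸ hgδ : 0 < T.det.val), hTd, hTdet, abs_of_pos hgδ]
    simp
    field_simp
  have hq : IsQSeries (fun z ↦ EisensteinSeries.E2 (T • z)) 1 :=
    isQSeries_E2.comp_affine hg hδ β fun z ↦ ⟨T • z, hTz z, rfl⟩
  convert hq.smul (g / δ) using 1
  · ext z
    have hy : (z.im : ℂ) ≠ 0 := by exact_mod_cast z.im_pos.ne'
    rw [hslash, E2star, hTim]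
    field_simp
    ring
  · rw [hdet]
    push_cast
    field_simp
    rfl

/-! ### The `q`-expansion of the twisted Eisenstein series -/

section

lemma stdAddChar_natCast {N : ℕ} [NeZero N] (n : ℕ) :
    ZMod.stdAddChar (n : ZMod N) = Complex.exp (2 * Real.pi * Complex.I * n / N) := by
  simpa using ZMod.stdAddChar_coe (N := N) n

lemma sum_zmod_eq_sum_range {M : Type*} [AddCommMonoid M] (N : ℕ) [NeZero N] (F : ZMod N → M) :
    ∑ a : ZMod N, F a = ∑ n ∈ Finset.range N, F n := by
  refine Finset.sum_bij' (fun a _ ↦ a.val) (fun n _ ↦ (n : ZMod N)) ?_ ?_ ?_ ?_ ?_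
  · simp [ZMod.val_lt]
  · simp
  · simp
  · intro n hn
    exact ZMod.val_cast_of_lt (by simpa using hn)
  · simp

lemma sum_range_mul_of_periodic {M : Type*} [AddCommMonoid M] {f : ℕ} {G : ℕ → M}
    (hG : ∀ n, G (n + f) = G n) (k : ℕ) :
    ∑ n ∈ Finset.range (k * f), G n = k • ∑ n ∈ Finset.range f, G n := by
  induction k with
  | zero => simp
  | succ k ih =>
    rw [add_mul, one_mul, add_comm, Finset.sum_range_add, add_smul, one_smul, ← ih, add_comm]
    congr 1
    exact Finset.sum_congr rfl fun n _ ↦ by rw [add_comm, hG]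

lemma sum_units_eq_sum {N : ℕ} [NeZero N] {M : Type*} [AddCommMonoid M] (F : ZMod N → M)
    (hF : ∀ x, ¬ IsUnit x → F x = 0) : ∑ u : (ZMod N)ˣ, F u = ∑ x, F x :=
  Fintype.sum_of_injective Units.val Units.val_injective _ _
    (fun x hx ↦ hF x fun ⟨u, hu⟩ ↦ hx ⟨u, hu⟩) fun _ ↦ rfl

variable {f : ℕ} {χ : DirichletCharacter ℂ f}

lemma inv_eq_self_of_sq (hχ : χ ^ 2 = 1) : χ⁻¹ = χ :=
  inv_eq_of_mul_eq_one_left (by rw [← sq, hχ])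

variable [NeZero f]

lemma sum_mul_stdAddChar (hprim : χ.IsPrimitive) (hχ : χ ^ 2 = 1) (n : ZMod f) :
    ∑ b : ZMod f, χ b * ZMod.stdAddChar (n * b) = χ n * gauss χ := by
  have := gaussSum_mulShift_of_isPrimitive ZMod.stdAddChar hprim n
  rwa [inv_eq_self_of_sq hχ] at this

lemma char_natCast_val_eq_zero {b : ZMod (f ^ 2)} (hb : ¬ IsUnit b) : χ (b.val : ZMod f) = 0 := by
  refine χ.map_nonunit fun h ↦ hb ?_
  rw [ZMod.isUnit_iff_coprime] at h
  rw [← ZMod.natCast_zmod_val b, ZMod.isUnit_iff_coprime]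
  exact Nat.Coprime.pow_right 2 h

/-- The Gauss sum of a primitive quadratic `χ` of conductor `f`, taken over the residues modulo
`f²`, is supported on the frequencies divisible by `f`. -/
lemma sum_sq_mul_stdAddChar (hprim : χ.IsPrimitive) (hχ : χ ^ 2 = 1) (m : ℕ) :
    ∑ b : ZMod (f ^ 2), χ (b.val : ZMod f) * ZMod.stdAddChar ((m : ZMod (f ^ 2)) * b) =
      if f ∣ m then f * (χ ((m / f : ℕ) : ZMod f) * gauss χ) else 0 := by
  have hf : (f : ℂ) ≠ 0 := NeZero.ne _
  have hsq : ∀ n : ℕ, χ (((n : ZMod (f ^ 2)).val : ℕ) : ZMod f) = χ (n : ZMod f) := by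
    intro n
    rw [ZMod.val_natCast]
    congr 1
    rw [ZMod.natCast_eq_natCast_iff]
    exact (Nat.mod_modEq n (f ^ 2)).of_dvd (Dvd.intro_left (f ^ 1) (by ring))
  split_ifs with hm
  · obtain ⟨k, rfl⟩ := hm
    rw [Nat.mul_div_cancel_left _ (NeZero.pos f), ← sum_mul_stdAddChar hprim hχ,
      sum_zmod_eq_sum_range, sum_zmod_eq_sum_range]
    have e : ∀ n : ℕ, χ (((n : ZMod (f ^ 2)).val : ℕ) : ZMod f) *
        ZMod.stdAddChar (((f * k : ℕ) : ZMod (f ^ 2)) * (n : ZMod (f ^ 2))) =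
        χ (n : ZMod f) * ZMod.stdAddChar (((k : ℕ) : ZMod f) * (n : ZMod f)) := by
      intro n
      rw [hsq, ← Nat.cast_mul, ← Nat.cast_mul, stdAddChar_natCast, stdAddChar_natCast]
      congr 2
      push_cast
      field_simp
    rw [Finset.sum_congr rfl fun n _ ↦ e n]
    have := sum_range_mul_of_periodic (f := f)
      (G := fun n : ℕ ↦ χ (n : ZMod f) * ZMod.stdAddChar (((k : ℕ) : ZMod f) * (n : ZMod f)))
      (fun n ↦ by simp) f
    rw [← sq] at this
    rw [this, nsmul_eq_mul]
  · set S := ∑ b : ZMod (f ^ 2), χ (b.val : ZMod f) * ZMod.stdAddChar ((m : ZMod (f ^ 2)) * b)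
    -- translating the summation variable by `f` multiplies the sum by a nontrivial root of unity
    have h1 : S = ZMod.stdAddChar (((m * f : ℕ)) : ZMod (f ^ 2)) * S := by
      rw [Finset.mul_sum]
      refine (Fintype.sum_equiv (Equiv.addRight (f : ZMod (f ^ 2))) _ _ fun b ↦ ?_).symm
      rw [Equiv.coe_addRight, mul_add, AddChar.map_add_eq_mul, Nat.cast_mul]
      have : χ (((b + (f : ZMod (f ^ 2))).val : ℕ) : ZMod f) = χ ((b.val : ℕ) : ZMod f) := by
        rw [← ZMod.natCast_zmod_val b, ← Nat.cast_add, hsq, hsq]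
        simp
      rw [this]
      ring
    have h2 : ZMod.stdAddChar (((m * f : ℕ)) : ZMod (f ^ 2)) ≠ 1 := by
      intro h
      have h0 : ((m * f : ℕ) : ZMod (f ^ 2)) = 0 := by
        apply ZMod.injective_stdAddChar
        rw [h, AddChar.map_zero_eq_one]
      rw [ZMod.natCast_eq_zero_iff, sq] at h0
      exact hm (Nat.dvd_of_mul_dvd_mul_right (NeZero.pos f) h0)
    have h3 : (ZMod.stdAddChar (((m * f : ℕ)) : ZMod (f ^ 2)) - 1) * S = 0 := by
      linear_combination -h1
    exact (mul_eq_zero.mp h3).resolve_left (sub_ne_zero.mpr h2)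

/-- Summability of the double series over `(j, m)` that underlies all the `q`-expansions. -/
lemma summable_double (z : ℍ) {c : ℕ+ × ℕ+ → ℂ} {K : ℝ} (hc : ∀ p, ‖c p‖ ≤ K) :
    Summable fun p : ℕ+ × ℕ+ ↦
      c p * ((p.1 : ℂ) * Complex.exp (2 * Real.pi * Complex.I * p.1 * p.2 * z)) := by
  have h := summable_prod_mul_pow (𝕜 := ℂ) 1 (UpperHalfPlane.norm_exp_two_pi_I_lt_one z)
  have h' := ((Equiv.prodComm ℕ+ ℕ+).summable_iff.mpr h).norm.mul_left K
  refine Summable.of_norm_bounded h' fun p ↦ ?_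
  rw [norm_mul]
  refine mul_le_mul (hc p) (le_of_eq ?_) (norm_nonneg _) ((norm_nonneg _).trans (hc p))
  simp only [Function.comp_apply, Equiv.prodComm_apply, Prod.fst_swap, Prod.snd_swap, pow_one]
  rw [← Complex.exp_nat_mul]
  congr 3
  push_cast
  ring

/-- The double series `∑_{j, m ≥ 1} j χ(j) χ(m) exp(2πi j m z)`. -/
def charSeries (χ : DirichletCharacter ℂ f) (z : ℍ) : ℂ :=
  ∑' p : ℕ+ × ℕ+, χ ((p.1 : ℕ) : ZMod f) * χ ((p.2 : ℕ) : ZMod f) *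
    ((p.1 : ℂ) * Complex.exp (2 * Real.pi * Complex.I * p.1 * p.2 * z))

lemma E2_eq_tsum_prod (z : ℍ) : EisensteinSeries.E2 z =
    1 - 24 * ∑' p : ℕ+ × ℕ+, ((p.1 : ℂ) * Complex.exp (2 * Real.pi * Complex.I * p.1 * p.2 * z)) := by
  have hr := UpperHalfPlane.norm_exp_two_pi_I_lt_one z
  rw [EisensteinSeries.E2_eq_tsum_cexp, ← tsum_prod_pow_eq_tsum_sigma 1 hr,
    ← (summable_prod_mul_pow 1 hr).tsum_prod, ← (Equiv.prodComm ℕ+ ℕ+).tsum_eq]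
  congr 2
  refine tsum_congr fun p ↦ ?_
  simp only [Equiv.prodComm_apply, Prod.fst_swap, Prod.snd_swap, pow_one]
  rw [← Complex.exp_nat_mul]
  congr 2
  push_cast
  ring

/-- Averaging `E₂` over the translates by `b / f` against a primitive quadratic `χ` twists its
`q`-expansion by `χ`. -/
lemma sum_char_mul_E2 (hprim : χ.IsPrimitive) (hχ : χ ^ 2 = 1) (z : ℍ) {w : ZMod f → ℍ}
    (hw : ∀ b, (w b : ℂ) = z + (b.val : ℂ) / f) :
    ∑ b : ZMod f, χ b * EisensteinSeries.E2 (w b) =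
      ∑ b : ZMod f, χ b - 24 * gauss χ * charSeries χ z := by
  have key (b : ZMod f) (p : ℕ+ × ℕ+) :
      Complex.exp (2 * Real.pi * Complex.I * p.1 * p.2 * w b) =
        ZMod.stdAddChar ((((p.1 : ℕ) * (p.2 : ℕ) : ℕ) : ZMod f) * b) *
          Complex.exp (2 * Real.pi * Complex.I * p.1 * p.2 * z) := by
    rw [← ZMod.natCast_zmod_val b, ← Nat.cast_mul, stdAddChar_natCast, ← Complex.exp_add, hw]
    congr 1
    simp only [ZMod.natCast_zmod_val]
    push_cast
    ring
  have hs : ∀ b ∈ (Finset.univ : Finset (ZMod f)), Summable fun p : ℕ+ × ℕ+ ↦ χ b *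
      ((p.1 : ℂ) * Complex.exp (2 * Real.pi * Complex.I * p.1 * p.2 * w b)) := fun b _ ↦
    summable_double (w b) (fun _ ↦ χ.norm_le_one b)
  calc ∑ b : ZMod f, χ b * EisensteinSeries.E2 (w b)
      = ∑ b : ZMod f, (χ b - 24 * ∑' p : ℕ+ × ℕ+, χ b *
          ((p.1 : ℂ) * Complex.exp (2 * Real.pi * Complex.I * p.1 * p.2 * w b))) := by
        refine Finset.sum_congr rfl fun b _ ↦ ?_
        rw [E2_eq_tsum_prod, tsum_mul_left]
        ring
    _ = _ := by
        rw [Finset.sum_sub_distrib, ← Finset.mul_sum, ← Summable.tsum_finsetSum hs, mul_assoc 24 (gauss χ)]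
        congr 2
        rw [charSeries, ← tsum_mul_left]
        refine tsum_congr fun p ↦ ?_
        simp only [key]
        have := sum_mul_stdAddChar hprim hχ (((p.1 : ℕ) * (p.2 : ℕ) : ℕ) : ZMod f)
        rw [Nat.cast_mul, map_mul] at this
        calc _ = (∑ b : ZMod f, χ b *
              ZMod.stdAddChar ((((p.1 : ℕ) * (p.2 : ℕ) : ℕ) : ZMod f) * b)) *
              ((p.1 : ℂ) * Complex.exp (2 * Real.pi * Complex.I * p.1 * p.2 * z)) := by
              rw [Finset.sum_mul]
              exact Finset.sum_congr rfl fun b _ ↦ by ring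
          _ = _ := by
              rw [Nat.cast_mul, this]
              ring

/-- The summation index `k ≡ A / f` runs over the fractions `j / f` with `j ≡ A` modulo `f`, which
turns `P` into a double series over positive integers. -/
lemma P_eq_tsum_prod (A B : ℤ) (z w : ℍ) (hw : (w : ℂ) = z / f) :
    P ((A : ℚ) / f) ((B : ℚ) / (f : ℚ) ^ 2) z = ∑' p : ℕ+ × ℕ+,
      (if ((p.1 : ℕ) : ZMod f) = (A : ZMod f) then
        (f : ℂ)⁻¹ * ZMod.stdAddChar (((p.2 : ℕ) : ZMod (f ^ 2)) * (B : ZMod (f ^ 2))) else 0) *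
      ((p.1 : ℂ) * Complex.exp (2 * Real.pi * Complex.I * p.1 * p.2 * w)) := by
  have hf0 : 0 < f := NeZero.pos f
  have hf : (f : ℂ) ≠ 0 := NeZero.ne _
  have hfQ : (f : ℚ) ≠ 0 := NeZero.ne _
  rw [Summable.tsum_prod (summable_double w (K := (f : ℝ)⁻¹) fun p ↦ by
    split_ifs
    · rw [norm_mul, ZMod.stdAddChar_apply, Circle.norm_coe]
      simp
    · simp)]
  have hk : ∀ k : {k : ℚ // 0 < k ∧ ∃ n : ℤ, k = (A : ℚ) / f + n},
      ∃ j : ℕ+, k.1 = (j : ℚ) / f ∧ ((j : ℕ) : ZMod f) = (A : ZMod f) := by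
    rintro ⟨k, hk0, n, hn⟩
    have hkf : k * f = ((A + n * f : ℤ) : ℚ) := by
      rw [hn]
      push_cast
      field_simp
    have hpos : 0 < A + n * f := by
      have : (0 : ℚ) < ((A + n * f : ℤ) : ℚ) := by
        rw [← hkf]
        positivity
      exact_mod_cast this
    obtain ⟨N, hN⟩ := Int.eq_ofNat_of_zero_le hpos.le
    refine ⟨⟨N, by omega⟩, ?_, ?_⟩
    · rw [eq_div_iff hfQ, hkf, hN]
      simp
    · have : ((N : ℤ) : ZMod f) = ((A + n * f : ℤ) : ZMod f) := by rw [hN]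
      simpa using this
  choose g hg hgA using hk
  have hinj : Function.Injective g := fun k k' h ↦ Subtype.ext (by rw [hg, hg, h])
  rw [P, ← hinj.tsum_eq]
  · refine tsum_congr fun k ↦ ?_
    simp only [hgA, if_true]
    rw [← tsum_mul_left]
    refine tsum_congr fun m ↦ ?_
    have hB : (ZMod.stdAddChar (((m : ℕ) : ZMod (f ^ 2)) * (B : ZMod (f ^ 2))) : ℂ) =
        Complex.exp (2 * Real.pi * Complex.I * (m * B) / (f : ℂ) ^ 2) := by
      have := ZMod.stdAddChar_coe (N := f ^ 2) ((m : ℕ) * B)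
      push_cast at this
      exact this
    have hkg : ((k.1 : ℚ) : ℂ) = (g k : ℂ) / f := by
      rw [hg]
      push_cast
      rfl
    rw [hB, hkg, mul_mul_mul_comm, ← Complex.exp_add]
    congr 1
    · field_simp
    · congr 1
      rw [hw]
      push_cast
      field_simp
      ring
  · intro j hj
    have hjA : ((j : ℕ) : ZMod f) = (A : ZMod f) := by
      by_contra hne
      simp [hne] at hj
    have hjA' : ((j : ℤ) : ZMod f) = (A : ZMod f) := by simpa using hjA
    rw [ZMod.intCast_eq_intCast_iff_dvd_sub] at hjA'
    obtain ⟨n, hn⟩ := hjA'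
    refine ⟨⟨(j : ℚ) / f, by positivity, -n, ?_⟩, ?_⟩
    · have : (A : ℚ) - j = f * n := by exact_mod_cast hn
      push_cast
      field_simp
      linarith
    · apply PNat.coe_injective
      have := hg ⟨(j : ℚ) / f, by positivity, -n, by
        have : (A : ℚ) - j = f * n := by exact_mod_cast hn
        push_cast
        field_simp
        linarith⟩
      rw [div_left_inj' hfQ] at this
      exact_mod_cast this.symm

/-- The character sums of the series `P_x` and `P_{-x}` occurring in `E_χ` (for `ε = 1` and
`ε = -1`) agree, because `χ` enters twice. -/
lemma sum_char_mul_P (hprim : χ.IsPrimitive) (hχ : χ ^ 2 = 1) (z : ℍ) {ε : ℤ}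
    (hε : ε = 1 ∨ ε = -1) :
    ∑ a : ZMod f, ∑ b : ZMod (f ^ 2), χ a * χ (b.val : ZMod f) *
      P (((ε * a.val : ℤ) : ℚ) / f) (((ε * b.val : ℤ) : ℚ) / (f : ℚ) ^ 2) z =
      gauss χ * charSeries χ z := by
  have hf0 : 0 < f := NeZero.pos f
  have hf : (f : ℂ) ≠ 0 := NeZero.ne _
  obtain ⟨w, hw⟩ : ∃ w : ℍ, (w : ℂ) = z / f := by
    refine ⟨⟨z / f, ?_⟩, rfl⟩
    rw [show (f : ℂ) = ((f : ℝ) : ℂ) by simp, Complex.div_ofReal_im]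
    have := z.im_pos
    positivity
  have hχε : χ (ε : ZMod f) * χ (ε : ZMod f) = 1 := by
    rw [← map_mul]
    rcases hε with rfl | rfl <;> simp
  have hεu : ∀ {N : ℕ}, (ε : ZMod N) * (ε : ZMod N) = 1 := by
    rcases hε with rfl | rfl <;> simp
  simp only [P_eq_tsum_prod _ _ z w hw]
  push_cast
  simp only [ZMod.natCast_zmod_val]
  set e : ℕ+ × ℕ+ → ℂ := fun p ↦
    (p.1 : ℂ) * Complex.exp (2 * Real.pi * Complex.I * p.1 * p.2 * w) with he
  have hsum : ∀ (a : ZMod f) (b : ZMod (f ^ 2)), Summable fun p : ℕ+ × ℕ+ ↦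
      χ a * χ (b.val : ZMod f) * ((if ((p.1 : ℕ) : ZMod f) = (ε : ZMod f) * a then
        (f : ℂ)⁻¹ * ZMod.stdAddChar (((p.2 : ℕ) : ZMod (f ^ 2)) * ((ε : ZMod (f ^ 2)) * b))
        else 0) * e p) := by
    intro a b
    refine Summable.mul_left _ (summable_double w (K := (f : ℝ)⁻¹) fun p ↦ ?_)
    split_ifs
    · rw [norm_mul, ZMod.stdAddChar_apply, Circle.norm_coe]
      simp
    · simp
  simp only [← tsum_mul_left]
  rw [Finset.sum_congr rfl fun a _ ↦ (Summable.tsum_finsetSum fun b _ ↦ hsum a b).symm,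
    ← Summable.tsum_finsetSum fun a _ ↦ summable_sum fun b _ ↦ hsum a b]
  have hterm (p : ℕ+ × ℕ+) : (∑ a : ZMod f, ∑ b : ZMod (f ^ 2),
      χ a * χ (b.val : ZMod f) * ((if ((p.1 : ℕ) : ZMod f) = (ε : ZMod f) * a then
        (f : ℂ)⁻¹ * ZMod.stdAddChar (((p.2 : ℕ) : ZMod (f ^ 2)) * ((ε : ZMod (f ^ 2)) * b))
        else 0) * e p)) =
      if f ∣ p.2 then gauss χ * (χ ((p.1 : ℕ) : ZMod f) *
        χ (((p.2 : ℕ) / f : ℕ) : ZMod f) * e p) else 0 := by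
    have hb : ∑ b : ZMod (f ^ 2), χ (b.val : ZMod f) *
        ZMod.stdAddChar (((p.2 : ℕ) : ZMod (f ^ 2)) * ((ε : ZMod (f ^ 2)) * b)) =
        χ (ε : ZMod f) * ∑ b : ZMod (f ^ 2), χ (b.val : ZMod f) *
          ZMod.stdAddChar (((p.2 : ℕ) : ZMod (f ^ 2)) * b) := by
      rw [Finset.mul_sum]
      refine Fintype.sum_bijective (fun b ↦ (ε : ZMod (f ^ 2)) * b)
        (Function.Involutive.bijective fun b ↦ by rw [← mul_assoc, hεu, one_mul]) _ _ fun b ↦ ?_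
      have hcast : ((((ε : ZMod (f ^ 2)) * b).val : ℕ) : ZMod f) =
          (ε : ZMod f) * ((b.val : ℕ) : ZMod f) := by
        have hd : f ∣ f ^ 2 := Dvd.intro_left (f ^ 1) (by ring)
        rw [ZMod.natCast_val, ZMod.natCast_val, ZMod.cast_mul hd, ZMod.cast_intCast hd]
      rw [hcast, map_mul χ]
      linear_combination (-(χ (b.val : ZMod f) * ZMod.stdAddChar
        (((p.2 : ℕ) : ZMod (f ^ 2)) * ((ε : ZMod (f ^ 2)) * b)))) * hχε
    have ha : ∀ a : ZMod f, ((p.1 : ℕ) : ZMod f) = (ε : ZMod f) * a ↔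
        a = (ε : ZMod f) * ((p.1 : ℕ) : ZMod f) := fun a ↦
      ⟨fun h ↦ by rw [h, ← mul_assoc, hεu, one_mul], fun h ↦ by rw [h, ← mul_assoc, hεu, one_mul]⟩
    simp only [ha, ite_mul, zero_mul, mul_ite, mul_zero]
    rw [Finset.sum_comm]
    simp only [Finset.sum_ite_eq', Finset.mem_univ, if_true, map_mul]
    calc _ = (f : ℂ)⁻¹ * χ (ε : ZMod f) * χ ((p.1 : ℕ) : ZMod f) * e p *
          ∑ b : ZMod (f ^ 2), χ (b.val : ZMod f) *
            ZMod.stdAddChar (((p.2 : ℕ) : ZMod (f ^ 2)) * ((ε : ZMod (f ^ 2)) * b)) := by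
          rw [Finset.mul_sum]
          exact Finset.sum_congr rfl fun b _ ↦ by ring
      _ = _ := by
          rw [hb, sum_sq_mul_stdAddChar hprim hχ]
          split_ifs
          · rw [show ∀ x y u v t : ℂ, x * y * u * v * (y * t) = (y * y) * (x * u * v * t) by
              intros; ring, hχε]
            field_simp
          · simp
  rw [tsum_congr hterm]
  obtain ⟨f', hf'⟩ : ∃ f' : ℕ+, (f' : ℕ) = f := ⟨⟨f, hf0⟩, rfl⟩
  have hinj : Function.Injective fun p : ℕ+ × ℕ+ ↦ (p.1, f' * p.2) := by
    rintro ⟨a, b⟩ ⟨a', b'⟩ h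
    simpa using h
  rw [← hinj.tsum_eq, charSeries, ← tsum_mul_left]
  · refine tsum_congr fun p ↦ ?_
    have h1 : ((f' * p.2 : ℕ+) : ℕ) = f * (p.2 : ℕ) := by rw [PNat.mul_coe, hf']
    simp only [he, h1, Nat.mul_div_cancel_left _ hf0, dvd_mul_right, if_true]
    congr 4
    rw [hw]
    push_cast
    field_simp
  · rintro ⟨j, m⟩ hp
    have hd : f ∣ (m : ℕ) := by
      by_contra hne
      simp [hne] at hp
    obtain ⟨k, hk⟩ := hd
    have hk0 : 0 < k := Nat.pos_of_ne_zero fun h ↦ m.pos.ne' (by simp [h] at hk)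
    exact ⟨(j, ⟨k, hk0⟩), Prod.ext rfl (PNat.coe_injective (by rw [PNat.mul_coe, hf', hk]; rfl))⟩

end

/-! ### `E_χ` as a twist of the Eisenstein series of level one -/

section

variable {f : ℕ} [NeZero f] {χ : DirichletCharacter ℂ f}

/-- The matrix `(f b; 0 f)` of the translation `z ↦ z + b / f`, with `b` represented in
`[0, f)`. -/
def shiftMat (b : ZMod f) : GL (Fin 2) ℝ :=
  Matrix.GeneralLinearGroup.mkOfDetNeZero !![(f : ℝ), (b.val : ℝ); 0, (f : ℝ)] (by
    simp [Matrix.det_fin_two, NeZero.ne f])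

lemma shiftMat_val (b : ZMod f) :
    (shiftMat b).val = !![(f : ℝ), (b.val : ℝ); 0, (f : ℝ)] := rfl

lemma det_shiftMat (b : ZMod f) : (shiftMat b).det.val = (f : ℝ) ^ 2 := by
  rw [Matrix.GeneralLinearGroup.val_det_apply, shiftMat_val, Matrix.det_fin_two]
  simp [sq]

lemma det_shiftMat_pos (b : ZMod f) : 0 < (shiftMat b).det.val := by
  have := NeZero.pos f
  rw [det_shiftMat]
  positivity

lemma coe_shiftMat_smul (b : ZMod f) (z : ℍ) :
    ((shiftMat b • z : ℍ) : ℂ) = z + (b.val : ℂ) / f := by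
  have hf : (f : ℂ) ≠ 0 := NeZero.ne _
  rw [UpperHalfPlane.coe_smul_of_det_pos (det_shiftMat_pos b)]
  simp only [num, denom, shiftMat_val]
  simp [-ZMod.natCast_val]
  field_simp

lemma im_shiftMat_smul (b : ZMod f) (z : ℍ) : (shiftMat b • z).im = z.im := by
  rw [← UpperHalfPlane.coe_im, coe_shiftMat_smul, show (b.val : ℂ) / f = ((b.val / f : ℝ) : ℂ) by
    push_cast; rfl, Complex.add_im, Complex.ofReal_im, add_zero, UpperHalfPlane.coe_im]

lemma slash_shiftMat (g : ℍ → ℂ) (b : ZMod f) (z : ℍ) :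
    (g ∣[(2 : ℤ)] shiftMat b) z = g (shiftMat b • z) := by
  have hf : (f : ℂ) ≠ 0 := NeZero.ne _
  rw [ModularForm.slash_apply, UpperHalfPlane.σ, if_pos (det_shiftMat_pos b), det_shiftMat,
    abs_of_nonneg (by positivity)]
  simp only [denom, shiftMat_val]
  simp
  field_simp

lemma sum_char_eq_zero_of_ne_one (hprim : χ.IsPrimitive) (hf : f ≠ 1) : ∑ b : ZMod f, χ b = 0 := by
  refine MulChar.sum_eq_zero_of_ne_one fun h ↦ hf ?_
  rw [← hprim, h, DirichletCharacter.conductor_one]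

/-- The contribution to `E_χ` of the constant and of the nonholomorphic terms. It vanishes unless
`f = 1`. -/
lemma sum_char_mul_const (hprim : χ.IsPrimitive) (hχ : χ ^ 2 = 1) (z : ℍ) :
    ∑ a : ZMod f, ∑ b : ZMod (f ^ 2), χ a * χ (b.val : ZMod f) *
      (((B2 ((a.val : ℚ) / f) : ℚ) : ℂ) / 2 -
        (if Int.fract ((a.val : ℚ) / f) = 0 ∧ Int.fract ((b.val : ℚ) / (f : ℚ) ^ 2) = 0 then
          Complex.I / (2 * Real.pi * ((z : ℂ) - (starRingEnd ℂ) (z : ℂ))) else 0)) =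
      1 / 12 * (∑ b : ZMod f, χ b) * (1 - 3 / (Real.pi * z.im)) := by
  by_cases hf : f = 1
  · subst hf
    have hz : (z : ℂ) - (starRingEnd ℂ) (z : ℂ) = 2 * Complex.I * z.im := by
      rw [Complex.sub_conj]
      push_cast
      rw [UpperHalfPlane.coe_im]
      ring
    have hy : (z.im : ℂ) ≠ 0 := by exact_mod_cast z.im_pos.ne'
    have hpi : (Real.pi : ℂ) ≠ 0 := by exact_mod_cast Real.pi_ne_zero
    have hI := Complex.I_ne_zero
    have hχ1 : χ = 1 := DirichletCharacter.level_one χ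
    rw [hz, hχ1]
    have hu : (Finset.univ : Finset (ZMod (1 ^ 2))) = {0} := rfl
    have hu' : (Finset.univ : Finset (ZMod 1)) = {0} := rfl
    rw [hu']
    have h1 : (1 : DirichletCharacter ℂ 1) 0 = 1 := by
      rw [show (0 : ZMod 1) = 1 from rfl, map_one]
    simp [h1, B2]
    field_simp
    ring
  · rw [sum_char_eq_zero_of_ne_one hprim hf, mul_zero, zero_mul]
    have h0 : ∑ b : ZMod (f ^ 2), χ (b.val : ZMod f) = 0 := by
      have := sum_sq_mul_stdAddChar hprim hχ 0
      have hnt : Nontrivial (ZMod f) := ZMod.nontrivial_iff.mpr hf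
      simpa [χ.map_nonunit not_isUnit_zero] using this
    refine Finset.sum_eq_zero fun a _ ↦ ?_
    by_cases ha : IsUnit a
    · have hfr : Int.fract ((a.val : ℚ) / f) ≠ 0 := by
        have hnt : Nontrivial (ZMod f) := ZMod.nontrivial_iff.mpr hf
        have hfQ : (0 : ℚ) < f := by exact_mod_cast NeZero.pos f
        rw [Int.fract_eq_self.mpr ⟨by positivity, by
          rw [div_lt_one hfQ]; exact_mod_cast a.val_lt⟩]
        have : a.val ≠ 0 := by
          rw [Ne, ZMod.val_eq_zero]
          exact ha.ne_zero
        positivity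
      simp only [hfr, false_and, if_false, sub_zero]
      rw [← Finset.sum_mul, ← Finset.mul_sum, h0]
      ring
    · simp [χ.map_nonunit ha]

/-- `E_χ` is the twist by `χ` of the completed Eisenstein series of level one. -/
lemma Echi_eq_sum_slash (hprim : χ.IsPrimitive) (hχ : χ ^ 2 = 1) :
    Echi χ = ∑ b : ZMod f, (-(1 / (24 * gauss χ)) * χ b) • (E2star ∣[(2 : ℤ)] shiftMat b) := by
  ext z
  have hR : (∑ b : ZMod f, (-(1 / (24 * gauss χ)) * χ b) • (E2star ∣[(2 : ℤ)] shiftMat b)) z =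
      -(1 / (24 * gauss χ)) * ((∑ b : ZMod f, χ b) * (1 - 3 / (Real.pi * z.im)) -
        24 * gauss χ * charSeries χ z) := by
    have hE := sum_char_mul_E2 hprim hχ z (w := fun b ↦ shiftMat b • z)
      fun b ↦ coe_shiftMat_smul b z
    rw [Finset.sum_apply, show (∑ b : ZMod f, χ b) * (1 - 3 / (Real.pi * z.im)) -
        24 * gauss χ * charSeries χ z = (∑ b : ZMod f, χ b - 24 * gauss χ * charSeries χ z) -
        (∑ b : ZMod f, χ b) * (3 / (Real.pi * z.im)) by ring, ← hE, Finset.sum_mul,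
      ← Finset.sum_sub_distrib, Finset.mul_sum]
    refine Finset.sum_congr rfl fun b _ ↦ ?_
    rw [Pi.smul_apply, slash_shiftMat, E2star, im_shiftMat_smul, smul_eq_mul]
    ring
  have hb (a : ZMod f) : ∑ b : (ZMod (f ^ 2))ˣ,
      χ a * χ ((b : ZMod (f ^ 2)).val : ZMod f) *
        heckePhi ((a.val : ℚ) / f) (((b : ZMod (f ^ 2)).val : ℚ) / (f : ℚ) ^ 2) z =
      ∑ b : ZMod (f ^ 2), χ a * χ (b.val : ZMod f) *
        heckePhi ((a.val : ℚ) / f) ((b.val : ℚ) / (f : ℚ) ^ 2) z :=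
    sum_units_eq_sum (fun b ↦ χ a * χ (b.val : ZMod f) *
        heckePhi ((a.val : ℚ) / f) ((b.val : ℚ) / (f : ℚ) ^ 2) z)
      fun b hb ↦ by simp only [char_natCast_val_eq_zero hb, mul_zero, zero_mul]
  have ha : ∑ a : (ZMod f)ˣ, ∑ b : (ZMod (f ^ 2))ˣ,
      χ (a : ZMod f) * χ ((b : ZMod (f ^ 2)).val : ZMod f) *
        heckePhi (((a : ZMod f).val : ℚ) / f) (((b : ZMod (f ^ 2)).val : ℚ) / (f : ℚ) ^ 2) z =
      ∑ a : ZMod f, ∑ b : ZMod (f ^ 2), χ a * χ (b.val : ZMod f) *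
        heckePhi ((a.val : ℚ) / f) ((b.val : ℚ) / (f : ℚ) ^ 2) z := by
    have h0 (a : ZMod f) (ha : ¬ IsUnit a) : ∑ b : ZMod (f ^ 2), χ a * χ (b.val : ZMod f) *
        heckePhi ((a.val : ℚ) / f) ((b.val : ℚ) / (f : ℚ) ^ 2) z = 0 :=
      Finset.sum_eq_zero fun b _ ↦ by rw [χ.map_nonunit ha, zero_mul, zero_mul]
    rw [← sum_units_eq_sum _ h0]
    exact Finset.sum_congr rfl fun a _ ↦ hb a
  have hP := sum_char_mul_P hprim hχ z (Or.inl rfl)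
  have hP' := sum_char_mul_P hprim hχ z (Or.inr rfl)
  have hc := sum_char_mul_const hprim hχ z
  have hsplit : ∑ a : ZMod f, ∑ b : ZMod (f ^ 2), χ a * χ (b.val : ZMod f) *
        heckePhi ((a.val : ℚ) / f) ((b.val : ℚ) / (f : ℚ) ^ 2) z =
      1 / 12 * (∑ b : ZMod f, χ b) * (1 - 3 / (Real.pi * z.im)) -
        gauss χ * charSeries χ z - gauss χ * charSeries χ z := by
    nth_rewrite 1 [← hP]
    rw [← hP', ← hc, ← Finset.sum_sub_distrib, ← Finset.sum_sub_distrib]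
    refine Finset.sum_congr rfl fun a _ ↦ ?_
    rw [← Finset.sum_sub_distrib, ← Finset.sum_sub_distrib]
    refine Finset.sum_congr rfl fun b _ ↦ ?_
    rw [heckePhi]
    push_cast
    simp only [one_mul, neg_mul, neg_div]
    ring
  rw [Echi, ha, hsplit, hR]
  ring

end

/-! ### Character sums over greatest common divisors -/

section

variable {f : ℕ} {χ : DirichletCharacter ℂ f}

lemma char_mul_self_of_isUnit (hχ : χ ^ 2 = 1) {a : ZMod f} (ha : IsUnit a) : χ a * χ a = 1 := by
  rw [← sq, ← MulChar.pow_apply' χ two_ne_zero, hχ, MulChar.one_apply ha]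

lemma isUnit_natCast_of_dvd {k K : ℕ} (hK : Nat.Coprime K f) (hk : k ∣ K) :
    IsUnit (k : ZMod f) := (ZMod.isUnit_iff_coprime _ _).mpr (hK.coprime_dvd_left hk)

variable [NeZero f]

/-- A primitive character is nontrivial on the stabilizer of any nonunit. -/
lemma exists_unit_mul_eq_self (hprim : χ.IsPrimitive) {u : ZMod f} (hu : ¬ IsUnit u) :
    ∃ l : (ZMod f)ˣ, (l : ZMod f) * u = u ∧ χ l ≠ 1 := by
  have hf0 : 0 < f := NeZero.pos f
  set g := Nat.gcd u.val f
  have hgf : g ∣ f := Nat.gcd_dvd_right _ _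
  have hg0 : 0 < g := Nat.pos_of_dvd_of_pos hgf hf0
  have hg1 : g ≠ 1 := by
    intro h
    apply hu
    rw [← ZMod.natCast_zmod_val u, ZMod.isUnit_iff_coprime]
    exact h
  have hd : f / g ∣ f := Nat.div_dvd_of_dvd hgf
  have hlt : f / g < f := Nat.div_lt_self hf0 (by omega)
  have hnot : ¬ χ.FactorsThrough (f / g) := fun h ↦ by
    have : χ.conductor ≤ f / g := Nat.sInf_le h
    rw [hprim] at this
    omega
  rw [DirichletCharacter.factorsThrough_iff_ker_unitsMap hd, SetLike.not_le_iff_exists] at hnot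
  obtain ⟨l, hl, hl'⟩ := hnot
  refine ⟨l, ?_, fun h ↦ hl' ?_⟩
  · have h1 : (((l : ZMod f).val : ℤ) : ZMod (f / g)) = ((1 : ℤ) : ZMod (f / g)) := by
      have := congrArg Units.val (MonoidHom.mem_ker.mp hl)
      rw [ZMod.unitsMap_val] at this
      simpa using this
    rw [eq_comm, ZMod.intCast_eq_intCast_iff_dvd_sub] at h1
    obtain ⟨k, hk⟩ := h1
    obtain ⟨m, hm⟩ : g ∣ u.val := Nat.gcd_dvd_left _ _
    have h2 : (f : ℤ) ∣ ((l : ZMod f).val * u.val : ℤ) - u.val := by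
      refine ⟨k * m, ?_⟩
      have h3 : ((f / g : ℕ) : ℤ) * g = f := by exact_mod_cast Nat.div_mul_cancel hgf
      have h4 : (u.val : ℤ) = g * m := by exact_mod_cast hm
      linear_combination (u.val : ℤ) * hk + ((f / g : ℕ) : ℤ) * k * h4 + k * m * h3
    rw [← ZMod.intCast_eq_intCast_iff_dvd_sub] at h2
    simpa using h2.symm
  · rw [MonoidHom.mem_ker]
    ext
    simpa using h

lemma eq_zero_of_eq_mul_self {c S : ℂ} (hc : c ≠ 1) (h : S = c * S) : S = 0 := by
  have h3 : (c - 1) * S = 0 := by linear_combination -h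
  exact (mul_eq_zero.mp h3).resolve_left (sub_ne_zero.mpr hc)

lemma sum_char_mul_comp_unit (l : (ZMod f)ˣ) (h : ZMod f → ℂ) :
    ∑ b, χ b * h b = χ l * ∑ b, χ b * h (l * b) := by
  rw [Finset.mul_sum]
  refine (Fintype.sum_bijective (fun b ↦ (l : ZMod f) * b) (Units.mulLeft_bijective l) _ _
    fun b ↦ ?_).symm
  rw [map_mul]
  ring

/-- For a function `h` invariant under the units, the sum `∑_b χ(b) h(u + b w)` depends on `u` and
`w` only through the factor `χ(u) χ(w)`. When `u` or `w` is not a unit, primitivity of `χ` makes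
the sum vanish. -/
lemma sum_char_mul_affine (hprim : χ.IsPrimitive) (hχ : χ ^ 2 = 1) {h : ZMod f → ℂ}
    (hinv : ∀ (l : (ZMod f)ˣ) c, h (l * c) = h c) (u w : ZMod f) :
    ∑ b, χ b * h (u + b * w) = χ u * χ w * ∑ b, χ b * h (1 + b) := by
  by_cases hw : IsUnit w
  · by_cases hu : IsUnit u
    · obtain ⟨u, rfl⟩ := hu
      obtain ⟨w, rfl⟩ := hw
      rw [sum_char_mul_comp_unit (u * w⁻¹)]
      have hw2 : χ ((w⁻¹ : (ZMod f)ˣ) : ZMod f) = χ (w : ZMod f) := by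
        have h1 := char_mul_self_of_isUnit hχ w.isUnit
        have h2 : χ ((w⁻¹ : (ZMod f)ˣ) : ZMod f) * χ (w : ZMod f) = 1 := by
          rw [← map_mul, Units.inv_mul, map_one]
        linear_combination (-χ ((w⁻¹ : (ZMod f)ˣ) : ZMod f)) * h1 + χ (w : ZMod f) * h2
      rw [Units.val_mul, map_mul, hw2]
      congr 1
      refine Finset.sum_congr rfl fun b _ ↦ ?_
      rw [← hinv u (1 + b)]
      congr 2
      calc (u : ZMod f) + u * (w⁻¹ : (ZMod f)ˣ) * b * w
          = u + u * ((w⁻¹ : (ZMod f)ˣ) * w) * b := by ring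
        _ = _ := by rw [Units.inv_mul]; ring
    · rw [χ.map_nonunit hu, zero_mul, zero_mul]
      obtain ⟨l, hl, hl1⟩ := exists_unit_mul_eq_self hprim hu
      refine eq_zero_of_eq_mul_self hl1 ?_
      refine (sum_char_mul_comp_unit l _).trans (congrArg _ (Finset.sum_congr rfl fun b _ ↦ ?_))
      rw [← hinv l (u + b * w), mul_add, hl, mul_assoc]
  · rw [χ.map_nonunit hw, mul_zero, zero_mul]
    obtain ⟨l, hl, hl1⟩ := exists_unit_mul_eq_self hprim hw
    refine eq_zero_of_eq_mul_self hl1 ?_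
    refine (sum_char_mul_comp_unit l _).trans (congrArg _ (Finset.sum_congr rfl fun b _ ↦ ?_))
    rw [mul_comm (l : ZMod f) b, mul_assoc, hl]

/-- The greatest common divisor with `f`, as a function on residue classes modulo `f`. -/
def gcdMod (c : ZMod f) : ℕ := Nat.gcd c.val f

lemma gcdMod_intCast (n : ℤ) : gcdMod (n : ZMod f) = Int.gcd n f := by
  have h : ((n : ZMod f).val : ℤ) = n % f := ZMod.val_intCast n
  rw [gcdMod, ← Int.gcd_natCast_natCast, h, Int.gcd_emod]

lemma gcdMod_unit_mul (l : (ZMod f)ˣ) (c : ZMod f) : gcdMod ((l : ZMod f) * c) = gcdMod c := by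
  have hl : Nat.Coprime (l : ZMod f).val f := ZMod.val_coe_unit_coprime l
  have : (l : ZMod f) * c = (((l : ZMod f).val * c.val : ℕ) : ℤ) := by simp
  rw [this, gcdMod_intCast, gcdMod, Int.gcd_natCast_natCast]
  exact Nat.Coprime.gcd_mul_left_cancel _ hl

/-- The character sum `∑_b χ(b) (1 + b, f)²` through which both `n_χ` and the constant terms of
`E_χ` are expressed. -/
def gcdCharSum (χ : DirichletCharacter ℂ f) : ℂ := ∑ b, χ b * (gcdMod (1 + b) : ℂ) ^ 2

lemma B2_intCast_div (A : ℤ) : B2 ((A : ℚ) / f) = B2 (((A : ZMod f).val : ℚ) / f) := by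
  have hf : (f : ℚ) ≠ 0 := NeZero.ne _
  have h : (((A : ZMod f).val : ℕ) : ℤ) = A % f := ZMod.val_intCast A
  have h2 : (A : ℚ) / f = (((A : ZMod f).val : ℕ) : ℚ) / f + ((A / f : ℤ) : ℚ) := by
    have h3 : (A : ℚ) = ((A % f : ℤ) : ℚ) + f * ((A / f : ℤ) : ℚ) := by
      exact_mod_cast (Int.emod_add_mul_ediv A f).symm
    rw [← h] at h3
    rw [Int.cast_natCast] at h3
    field_simp
    linarith
  rw [B2, B2, h2, Int.fract_add_intCast]

lemma sum_B2_div : ∑ c : ZMod f, B2 ((c.val : ℚ) / f) = 1 / (6 * f) := by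
  have hf : (f : ℚ) ≠ 0 := NeZero.ne _
  have hf0 : (0 : ℚ) < f := by exact_mod_cast NeZero.pos f
  have hsum (k : ℕ) : ∑ n ∈ Finset.range k, (((n : ℚ) / f) ^ 2 - (n : ℚ) / f + 1 / 6) =
      (k : ℚ) * (k - 1) * (2 * k - 1) / (6 * f ^ 2) - k * (k - 1) / (2 * f) + k / 6 := by
    induction k with
    | zero => simp
    | succ k ih =>
      rw [Finset.sum_range_succ, ih]
      push_cast
      field_simp
      ring
  rw [sum_zmod_eq_sum_range]
  have : ∀ n ∈ Finset.range f, B2 (((n : ZMod f).val : ℚ) / f) =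
      ((n : ℚ) / f) ^ 2 - (n : ℚ) / f + 1 / 6 := by
    intro n hn
    have hn' : n < f := by simpa using hn
    rw [ZMod.val_cast_of_lt hn', B2, Int.fract_eq_self.mpr ⟨by positivity, by
      rw [div_lt_one hf0]; exact_mod_cast hn'⟩]
  rw [Finset.sum_congr rfl this, hsum]
  field_simp
  ring

/-- The distribution relation for `B₂`, summed over the multiples of a residue class. -/
lemma sum_B2_mul (c : ZMod f) :
    ∑ a : ZMod f, B2 (((a * c).val : ℚ) / f) = (gcdMod c : ℚ) ^ 2 / (6 * f) := by
  have hf : (f : ℚ) ≠ 0 := NeZero.ne _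
  obtain ⟨m, hm⟩ : gcdMod c ∣ f := Nat.gcd_dvd_right _ _
  obtain ⟨n, hn⟩ : gcdMod c ∣ c.val := Nat.gcd_dvd_left _ _
  have hg0 : 0 < gcdMod c := Nat.gcd_pos_of_pos_right _ (NeZero.pos f)
  have hcop : Nat.Coprime n m := by
    have h : Nat.gcd (gcdMod c * n) (gcdMod c * m) = gcdMod c := by rw [← hm, ← hn]; rfl
    rw [Nat.gcd_mul_left] at h
    exact Nat.eq_of_mul_eq_mul_left hg0 (by rw [h, mul_one])
  have hm0 : NeZero m := ⟨by
    rintro rfl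
    exact NeZero.ne f (by simpa using hm)⟩
  have hmQ : (m : ℚ) ≠ 0 := NeZero.ne _
  have hgQ : (gcdMod c : ℚ) ≠ 0 := by exact_mod_cast hg0.ne'
  have hfQ : (f : ℚ) = gcdMod c * m := by exact_mod_cast hm
  have hterm (a : ℕ) : B2 ((((a : ZMod f) * c).val : ℚ) / f) =
      B2 ((((a : ZMod m) * (n : ZMod m)).val : ℚ) / m) := by
    have h1 : (a : ZMod f) * c = ((a * c.val : ℤ) : ZMod f) := by simp
    have h2 : (a : ZMod m) * (n : ZMod m) = ((a * n : ℤ) : ZMod m) := by simp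
    rw [h1, h2, ← B2_intCast_div, ← B2_intCast_div]
    congr 1
    have : (c.val : ℚ) = gcdMod c * n := by exact_mod_cast hn
    push_cast
    rw [this, hfQ]
    field_simp
  rw [sum_zmod_eq_sum_range]
  simp only [hterm]
  have hper := sum_range_mul_of_periodic (f := m)
    (G := fun a : ℕ ↦ B2 ((((a : ZMod m) * (n : ZMod m)).val : ℚ) / m)) (fun a ↦ by simp)
    (gcdMod c)
  rw [← hm] at hper
  rw [hper, ← sum_zmod_eq_sum_range m (fun a ↦ B2 (((a * (n : ZMod m)).val : ℚ) / m))]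
  have hbij := Fintype.sum_bijective (fun a : ZMod m ↦ a * (n : ZMod m))
    (Units.mulRight_bijective (ZMod.unitOfCoprime n hcop))
    (fun a ↦ B2 (((a * (n : ZMod m)).val : ℚ) / m)) (fun a ↦ B2 ((a.val : ℚ) / m)) fun _ ↦ rfl
  rw [hbij, sum_B2_div, nsmul_eq_mul, hfQ]
  field_simp

lemma nchi_eq (hprim : χ.IsPrimitive) (hχ : χ ^ 2 = 1) :
    nchi χ = -(1 / (24 * gauss χ)) * gcdCharSum χ := by
  have hf : (f : ℂ) ≠ 0 := NeZero.ne _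
  set β : ZMod f → ℂ := fun c ↦ ((B2 ((c.val : ℚ) / f) : ℚ) : ℂ) with hβ
  have h1 (a b : ZMod f) : ((B2 (((a.val : ℚ) + (b.val : ℚ)) / f) : ℚ) : ℂ) = β (a + b) := by
    have h2 : a + b = ((a.val + b.val : ℤ) : ZMod f) := by simp
    rw [hβ]
    simp only
    rw [h2, ← B2_intCast_div]
    push_cast
    rfl
  -- for a unit `a` put `b = a b'`; for a nonunit `a` both sides vanish
  have h2 (a : ZMod f) : ∑ b, χ a * χ b * β (a + b) = ∑ b, χ b * β (a * (1 + b)) := by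
    by_cases ha : IsUnit a
    · obtain ⟨a, rfl⟩ := ha
      simp only [mul_assoc]
      rw [← Finset.mul_sum, sum_char_mul_comp_unit a, ← mul_assoc,
        char_mul_self_of_isUnit hχ a.isUnit, one_mul]
      exact Finset.sum_congr rfl fun b _ ↦ by rw [mul_add, mul_one]
    · obtain ⟨l, hl, hl1⟩ := exists_unit_mul_eq_self hprim ha
      rw [show ∑ b, χ b * β (a * (1 + b)) = 0 from ?_]
      · simp [χ.map_nonunit ha]
      · refine eq_zero_of_eq_mul_self hl1 ?_
        refine (sum_char_mul_comp_unit l _).trans (congrArg _ (Finset.sum_congr rfl fun b _ ↦ ?_))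
        rw [mul_add, mul_add, mul_left_comm, ← mul_assoc, hl]
  have h3 : ∑ a, ∑ b, χ a * χ b * β (a + b) = gcdCharSum χ / (6 * f) := by
    rw [Finset.sum_congr rfl fun a _ ↦ h2 a, Finset.sum_comm, gcdCharSum, Finset.sum_div]
    refine Finset.sum_congr rfl fun b _ ↦ ?_
    rw [← Finset.mul_sum, mul_div_assoc]
    congr 1
    have := congrArg (fun x : ℚ ↦ (x : ℂ)) (sum_B2_mul (1 + b))
    push_cast at this
    exact this
  rw [nchi]
  simp only [h1]
  rw [h3]
  field_simp
  ring

lemma sum_char_mul_gcd (hprim : χ.IsPrimitive) (hχ : χ ^ 2 = 1) {d u w : ℤ} (h : IsCoprime u w) :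
    ∑ b : ZMod f, χ b * (Int.gcd (d * u + b.val * (d * w)) (f * (d * w)) : ℂ) ^ 2 =
      (d : ℂ) ^ 2 * (χ (u : ZMod f) * χ (w : ZMod f)) * gcdCharSum χ := by
  have key (b : ZMod f) : (Int.gcd (d * u + b.val * (d * w)) (f * (d * w)) : ℂ) ^ 2 =
      (d : ℂ) ^ 2 * (gcdMod ((u : ZMod f) + b * (w : ZMod f)) : ℂ) ^ 2 := by
    have h1 : (u : ZMod f) + b * (w : ZMod f) = ((u + b.val * w : ℤ) : ZMod f) := by simp
    rw [h1, gcdMod_intCast, show d * u + b.val * (d * w) = d * (u + b.val * w) by ring,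
      show (f : ℤ) * (d * w) = d * (f * w) by ring, Int.gcd_mul_left]
    have h2 : Int.gcd (u + b.val * w) (f * w) = Int.gcd (u + b.val * w) f := by
      have h3 : IsCoprime (u + b.val * w) w := by
        simpa [mul_comm] using h.add_mul_left_left (b.val : ℤ)
      rw [Int.isCoprime_iff_gcd_eq_one] at h3
      rw [Int.gcd_def, Int.natAbs_mul]
      exact Nat.Coprime.gcd_mul_right_cancel_right _ (Nat.Coprime.symm h3)
    rw [h2, Nat.cast_mul, mul_pow]
    congr 1
    have : ((d.natAbs : ℤ) : ℂ) ^ 2 = (d : ℂ) ^ 2 := by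
      rw [← Int.cast_pow, Int.natAbs_sq, Int.cast_pow]
    simpa using this
  simp only [key]
  have := sum_char_mul_affine hprim hχ (h := fun c ↦ (gcdMod c : ℂ) ^ 2)
    (fun l c ↦ by simp only [gcdMod_unit_mul]) (u : ZMod f) (w : ZMod f)
  rw [gcdCharSum, mul_assoc, ← this, Finset.mul_sum]
  exact Finset.sum_congr rfl fun b _ ↦ by ring

/-- The sum of squares of contents giving the constant term of `E_χ` along the vector `(K u, w)`,
for coprime `u` and `w`: scaling the first entry by `K` multiplies it by `χ(K) (K, w)²`. -/
lemma sum_char_mul_gcd_scaled (hprim : χ.IsPrimitive) (hχ : χ ^ 2 = 1) {u w : ℤ}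
    (h : IsCoprime u w) {K : ℕ} (hK0 : K ≠ 0) (hK : Nat.Coprime K f) :
    ∑ b : ZMod f, χ b * (Int.gcd (f * (K * u) + b.val * w) (f * w) : ℂ) ^ 2 =
      (if (f : ℤ) ∣ w then χ (u : ZMod f) * χ ((w / f : ℤ) : ZMod f) else 0) *
        ((f : ℂ) ^ 2 * gcdCharSum χ) * (χ (K : ZMod f) * (Int.gcd K w : ℂ) ^ 2) := by
  have hf0 : 0 < f := NeZero.pos f
  have hf0' : (f : ℤ) ≠ 0 := by exact_mod_cast hf0.ne'
  by_cases hw : (f : ℤ) ∣ w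
  · rw [if_pos hw]
    obtain ⟨w, rfl⟩ := hw
    rw [Int.mul_ediv_cancel_left _ hf0']
    have hk : Int.gcd K (f * w) = Int.gcd K w := by
      rw [Int.gcd_def, Int.gcd_def, Int.natAbs_mul]
      exact Nat.Coprime.gcd_mul_left_cancel_right _ (by simpa using hK.symm)
    rw [hk]
    obtain ⟨K', hK'⟩ := Int.gcd_dvd_left (K : ℤ) w
    obtain ⟨w', hw'⟩ := Int.gcd_dvd_right (K : ℤ) w
    have hkK : Int.gcd K w ∣ K := by exact_mod_cast Int.gcd_dvd_left (K : ℤ) w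
    have hk0 : Int.gcd K w ≠ 0 := by
      intro h0
      simp [h0] at hkK
      exact hK0 hkK
    set k := Int.gcd K w
    have hk0' : (k : ℤ) ≠ 0 := by exact_mod_cast hk0
    have hcop : IsCoprime (K' * u) w' := by
      refine IsCoprime.mul_left ?_ ?_
      · rw [Int.isCoprime_iff_gcd_eq_one]
        have h1 : Int.gcd (k * K') (k * w') = k := by rw [← hK', ← hw']
        rw [Int.gcd_mul_left, Int.natAbs_natCast] at h1
        exact Nat.eq_of_mul_eq_mul_left (Nat.pos_of_ne_zero hk0) (by rw [h1, mul_one])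
      · rw [hw'] at h
        exact h.of_isCoprime_of_dvd_right ⟨f * k, by ring⟩
    have hs := sum_char_mul_gcd (d := f * k) hprim hχ hcop
    have e1 : (f : ℤ) * (K * u) = f * k * (K' * u) := by rw [hK']; ring
    have e2 : (f : ℤ) * w = f * k * w' := by rw [mul_assoc, ← hw']
    rw [e1, e2, hs]
    have hχK : χ (K : ZMod f) = χ (k : ZMod f) * χ (K' : ZMod f) := by
      rw [← map_mul]
      congr 1
      have := congrArg (fun n : ℤ ↦ (n : ZMod f)) hK'
      simpa using this
    have hχw : χ (w : ZMod f) = χ (k : ZMod f) * χ (w' : ZMod f) := by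
      rw [← map_mul]
      congr 1
      have := congrArg (fun n : ℤ ↦ (n : ZMod f)) hw'
      simpa using this
    have hχk := char_mul_self_of_isUnit hχ (isUnit_natCast_of_dvd hK hkK)
    rw [hχK, hχw]
    push_cast
    rw [map_mul]
    linear_combination (-((f : ℂ) ^ 2 * (k : ℂ) ^ 2 * χ (K' : ZMod f) * χ (u : ZMod f) *
      χ (w' : ZMod f) * gcdCharSum χ)) * hχk
  · rw [if_neg hw, zero_mul, zero_mul]
    set d := Int.gcd (f * (K * u)) w with hd
    have hd0 : d ≠ 0 := by
      intro h0
      rw [hd, Int.gcd_eq_zero_iff] at h0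
      exact hw (h0.2 ▸ dvd_zero _)
    obtain ⟨X, hX⟩ := Int.gcd_dvd_left (f * (K * u) : ℤ) w
    obtain ⟨Y, hY⟩ := Int.gcd_dvd_right (f * (K * u) : ℤ) w
    rw [← hd] at hX hY
    have hcop : IsCoprime X Y := by
      rw [Int.isCoprime_iff_gcd_eq_one]
      have h1 : Int.gcd (d * X) (d * Y) = d := by rw [← hX, ← hY]
      rw [Int.gcd_mul_left, Int.natAbs_natCast] at h1
      exact Nat.eq_of_mul_eq_mul_left (Nat.pos_of_ne_zero hd0) (by rw [h1, mul_one])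
    have hs := sum_char_mul_gcd (d := d) hprim hχ hcop
    rw [← hX, ← hY] at hs
    rw [hs, χ.map_nonunit (a := (X : ZMod f)), zero_mul, mul_zero, zero_mul]
    -- if `X` were prime to `f`, then `f` would divide the content `d`
    intro hu
    rw [ZMod.coe_int_isUnit_iff_isCoprime] at hu
    have : (f : ℤ) ∣ d := hu.dvd_of_dvd_mul_right ⟨K * u, hX.symm⟩
    exact hw (this.trans ⟨Y, hY⟩)

end

/-! ### The operators `[p]⁺` and `[p]⁻` and their local factors -/

section

lemma gammaMat_val {p : ℕ} (hp : p ≠ 0) :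
    (gammaMat p).val = (!![(p : ℤ), 0; 0, 1] : Matrix (Fin 2) (Fin 2) ℤ).map
      (Int.cast : ℤ → ℝ) := by
  rw [gammaMat, dif_neg hp]
  ext i j
  fin_cases i <;> fin_cases j <;> simp [Matrix.GeneralLinearGroup.mkOfDetNeZero]

lemma HasCuspValues.sub_smul_gammaMat {g : ℍ → ℂ} {κ : ℂ} {F : ℤ → ℤ → ℂ}
    (h : HasCuspValues g κ F) {p : ℕ} (hp : p ≠ 0) (c : ℂ) :
    HasCuspValues (g - c • (g ∣[(2 : ℤ)] gammaMat p)) (κ * (1 - c))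
      (fun u w ↦ F u w - c / p * F (p * u) w) := by
  have hdet : (!![(p : ℤ), 0; 0, 1] : Matrix (Fin 2) (Fin 2) ℤ).det = p := by
    simp [Matrix.det_fin_two]
  have hs := h.slash (gammaMat_val hp) (by rw [hdet]; positivity)
  convert h.sub_smul hs c using 1
  · ring
  · ext u w
    rw [hdet]
    simp
    ring

/-- Cusp values of a composition of operators `1 - c(p) γ_p`. -/
lemma HasCuspValues.foldr {g : ℍ → ℂ} {κ : ℂ} {F : ℤ → ℤ → ℂ} (h : HasCuspValues g κ F)
    (c : ℕ → ℂ) {l : List ℕ} (hl : ∀ p ∈ l, p ≠ 0) :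
    HasCuspValues (l.foldr (fun p g ↦ g - c p • (g ∣[(2 : ℤ)] gammaMat p)) g)
      (κ * (l.map fun p ↦ 1 - c p).prod)
      (l.foldr (fun p F u w ↦ F u w - c p / p * F (p * u) w) F) := by
  induction l with
  | nil => simpa using h
  | cons p l ih =>
    have := (ih fun q hq ↦ hl q (List.mem_cons_of_mem _ hq)).sub_smul_gammaMat
      (hl p List.mem_cons_self) (c p)
    rw [List.map_cons, List.prod_cons, mul_comm (1 - c p), ← mul_assoc]
    exact this

variable {f : ℕ} {χ : DirichletCharacter ℂ f}

/-- Along the vectors `(K u, w)`, with `K` supported on the finite set of primes `S`, the function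
`F` is `A χ(K)` times an Euler product with local factors `e p (v_p K)`. -/
def HasEulerProduct (χ : DirichletCharacter ℂ f) (S : Finset ℕ) (u w : ℤ) (F : ℤ → ℤ → ℂ) (A : ℂ)
    (e : ℕ → ℕ → ℂ) : Prop :=
  ∀ K : ℕ, K ≠ 0 → K.primeFactors ⊆ S →
    F (K * u) w = A * (χ (K : ZMod f) * ∏ p ∈ S, e p (K.factorization p))

lemma HasEulerProduct.sub_mul (hχ : χ ^ 2 = 1) {S : Finset ℕ} {u w : ℤ} {F : ℤ → ℤ → ℂ} {A : ℂ}
    {e : ℕ → ℕ → ℂ} (h : HasEulerProduct χ S u w F A e) {q : ℕ} (hq : q.Prime) (hqS : q ∈ S)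
    (hqf : Nat.Coprime q f) (τ : ℂ) :
    HasEulerProduct χ S u w (fun u w ↦ F u w - χ (q : ZMod f) * τ * F (q * u) w) A
      (Function.update e q fun k ↦ e q k - τ * e q (k + 1)) := by
  intro K hK0 hKS
  have hqK : (q * K).primeFactors ⊆ S := by
    rw [Nat.primeFactors_mul hq.ne_zero hK0, hq.primeFactors]
    exact Finset.union_subset (by simpa using hqS) hKS
  have h1 := h K hK0 hKS
  have h2 := h (q * K) (mul_ne_zero hq.ne_zero hK0) hqK
  push_cast at h2
  rw [mul_assoc, map_mul] at h2
  have hqq := char_mul_self_of_isUnit hχ ((ZMod.isUnit_iff_coprime q f).mpr hqf)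
  have hrest : ∏ p ∈ S.erase q, e p ((q * K).factorization p) =
      ∏ p ∈ S.erase q, e p (K.factorization p) := by
    refine Finset.prod_congr rfl fun p hp ↦ ?_
    rw [Nat.factorization_mul hq.ne_zero hK0, hq.factorization, Finsupp.add_apply,
      Finsupp.single_eq_of_ne (Finset.ne_of_mem_erase hp), zero_add]
  have hrest' : ∏ p ∈ S.erase q,
      (Function.update e q fun k ↦ e q k - τ * e q (k + 1)) p (K.factorization p) =
      ∏ p ∈ S.erase q, e p (K.factorization p) := by
    refine Finset.prod_congr rfl fun p hp ↦ ?_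
    rw [Function.update_of_ne (Finset.ne_of_mem_erase hp)]
  have hself : (q * K).factorization q = K.factorization q + 1 := by
    rw [Nat.factorization_mul hq.ne_zero hK0, hq.factorization, Finsupp.add_apply,
      Finsupp.single_eq_same, add_comm]
  rw [← Finset.mul_prod_erase S _ hqS] at h1 h2 ⊢
  rw [hrest, hself] at h2
  rw [hrest', Function.update_self]
  simp only [h1, h2]
  linear_combination (-(τ * A * χ (K : ZMod f) * e q (K.factorization q + 1) *
    ∏ p ∈ S.erase q, e p (K.factorization p))) * hqq

lemma HasEulerProduct.foldr (hχ : χ ^ 2 = 1) {S : Finset ℕ} {u w : ℤ} {F : ℤ → ℤ → ℂ} {A : ℂ}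
    {e : ℕ → ℕ → ℂ} (h : HasEulerProduct χ S u w F A e) {c τ : ℕ → ℂ} {l : List ℕ}
    (hl : l.Nodup) (hlp : ∀ p ∈ l, p.Prime ∧ p ∈ S ∧ Nat.Coprime p f)
    (hc : ∀ p ∈ l, c p / p = χ (p : ZMod f) * τ p) :
    HasEulerProduct χ S u w (l.foldr (fun p F u w ↦ F u w - c p / p * F (p * u) w) F) A
      (fun p k ↦ if p ∈ l then e p k - τ p * e p (k + 1) else e p k) := by
  induction l with
  | nil => simpa using h
  | cons q l ih =>
    rw [List.nodup_cons] at hl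
    obtain ⟨hq, hqS, hqf⟩ := hlp q List.mem_cons_self
    have := (ih hl.2 (fun p hp ↦ hlp p (List.mem_cons_of_mem _ hp))
      (fun p hp ↦ hc p (List.mem_cons_of_mem _ hp))).sub_mul hχ hq hqS hqf (τ q)
    rw [← hc q List.mem_cons_self] at this
    have he : (fun p k ↦ if p ∈ q :: l then e p k - τ p * e p (k + 1) else e p k) =
        Function.update (fun p k ↦ if p ∈ l then e p k - τ p * e p (k + 1) else e p k) q fun k ↦
          (if q ∈ l then e q k - τ q * e q (k + 1) else e q k) -
            τ q * if q ∈ l then e q (k + 1) - τ q * e q (k + 1 + 1) else e q (k + 1) := by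
      ext p k
      by_cases hp : p = q
      · subst hp
        simp [hl.1]
      · simp [hp]
    rw [he]
    exact this

lemma gcd_prod_pow {S : Finset ℕ} (hS : ∀ p ∈ S, p.Prime) (k : ℕ → ℕ) (n : ℕ) :
    Nat.gcd (∏ p ∈ S, p ^ k p) n = ∏ p ∈ S, Nat.gcd (p ^ k p) n := by
  induction S using Finset.induction_on with
  | empty => simp
  | insert q S hq ih =>
    rw [Finset.prod_insert hq, Finset.prod_insert hq,
      ← ih fun p hp ↦ hS p (Finset.mem_insert_of_mem hp), Nat.gcd_comm, Nat.Coprime.gcd_mul,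
      Nat.gcd_comm n, Nat.gcd_comm n]
    refine Nat.Coprime.prod_right fun p hp ↦ Nat.Coprime.pow _ _ ?_
    refine (Nat.coprime_primes (hS q (Finset.mem_insert_self q S))
      (hS p (Finset.mem_insert_of_mem hp))).mpr ?_
    rintro rfl
    exact hq hp

lemma gcd_eq_prod_of_primeFactors_subset {S : Finset ℕ} (hS : ∀ p ∈ S, p.Prime) {K : ℕ}
    (hK : K ≠ 0) (hKS : K.primeFactors ⊆ S) (n : ℕ) :
    Nat.gcd K n = ∏ p ∈ S, Nat.gcd (p ^ K.factorization p) n := by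
  rw [← gcd_prod_pow hS]
  congr 1
  conv_lhs => rw [← Nat.prod_factorization_pow_eq_self hK]
  rw [Finsupp.prod, Nat.support_factorization]
  refine Finset.prod_subset hKS fun p _ hp ↦ ?_
  rw [← Nat.support_factorization, Finsupp.notMem_support_iff] at hp
  rw [hp, pow_zero]

variable [NeZero f]

/-- The function giving the constant terms of `E_χ`, as the combination of squares of contents
that comes from the translates of the Eisenstein series of level one. -/
def cuspValue (χ : DirichletCharacter ℂ f) (u w : ℤ) : ℂ :=
  ∑ b : ZMod f, -(1 / (24 * gauss χ)) * χ b *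
    ((Int.gcd (f * u + b.val * w) (0 * u + f * w) : ℂ) ^ 2 / ((f : ℤ) ^ 2 : ℤ))

lemma hasCuspValues_Echi (hprim : χ.IsPrimitive) (hχ : χ ^ 2 = 1) :
    HasCuspValues (Echi χ) (∑ b : ZMod f, -(1 / (24 * gauss χ)) * χ b * (-3 / Real.pi))
      (cuspValue χ) := by
  rw [Echi_eq_sum_slash hprim hχ]
  refine HasCuspValues.sum _ fun b _ ↦ HasCuspValues.smul ?_ _
  have hdet : (!![(f : ℤ), (b.val : ℤ); 0, (f : ℤ)] : Matrix (Fin 2) (Fin 2) ℤ).det =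
      (f : ℤ) ^ 2 := by
    rw [Matrix.det_fin_two]
    simp [sq]
  have := hasCuspValues_E2star.slash (A := shiftMat b)
    (B := !![(f : ℤ), (b.val : ℤ); 0, (f : ℤ)])
    (by
      rw [shiftMat_val]
      ext i j
      fin_cases i <;> fin_cases j <;> simp)
    (by
      rw [hdet]
      have := NeZero.pos f
      positivity)
  rw [hdet] at this
  exact this

/-- The value of `cuspValue` at a primitive vector `(u, w)`, in closed form. -/
def primitiveCuspValue (χ : DirichletCharacter ℂ f) (u w : ℤ) : ℂ :=
  nchi χ * if (f : ℤ) ∣ w then χ (u : ZMod f) * χ ((w / f : ℤ) : ZMod f) else 0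

lemma hasEulerProduct_cuspValue (hprim : χ.IsPrimitive) (hχ : χ ^ 2 = 1) {u w : ℤ}
    (h : IsCoprime u w) {S : Finset ℕ} (hS : ∀ p ∈ S, p.Prime ∧ Nat.Coprime p f) :
    HasEulerProduct χ S u w (cuspValue χ) (primitiveCuspValue χ u w)
      (fun p k ↦ (Nat.gcd (p ^ k) w.natAbs : ℂ) ^ 2) := by
  intro K hK0 hKS
  have hf : (f : ℂ) ≠ 0 := NeZero.ne _
  have hKf : Nat.Coprime K f := by
    refine Nat.coprime_of_dvd fun p hp hpK hpf ↦ ?_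
    have := (hS p (hKS (Nat.mem_primeFactors.mpr ⟨hp, hpK, hK0⟩))).2
    exact hp.one_lt.ne' (Nat.eq_one_of_dvd_coprimes this dvd_rfl hpf)
  have hs := sum_char_mul_gcd_scaled hprim hχ h hK0 hKf
  rw [primitiveCuspValue, nchi_eq hprim hχ, Finset.prod_pow, ← Nat.cast_prod,
    ← gcd_eq_prod_of_primeFactors_subset (fun p hp ↦ (hS p hp).1) hK0 hKS]
  rw [Int.gcd_def, Int.natAbs_natCast] at hs
  have hsum : cuspValue χ (K * u) w = -(1 / (24 * gauss χ)) / (f : ℂ) ^ 2 *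
      ∑ b : ZMod f, χ b * (Int.gcd (f * (K * u) + b.val * w) (f * w) : ℂ) ^ 2 := by
    rw [cuspValue, Finset.mul_sum]
    refine Finset.sum_congr rfl fun b _ ↦ ?_
    rw [zero_mul, zero_add]
    push_cast
    ring
  rw [hsum, hs]
  field_simp

/-- The local factor at `p` of the constant term of `E_{M,L,χ}` at a cusp represented by a
primitive vector with second entry `w`. It arises from the sequence `k ↦ (p ^ k, w)²` by applying
the operators `[p]⁺` if `inM` holds and `[p]⁻` if `inL` holds. -/
def localFactor (p : ℕ) (inM inL : Prop) [Decidable inM] [Decidable inL] (w : ℤ) : ℂ :=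
  let G : ℕ → ℂ := fun k ↦ (Nat.gcd (p ^ k) w.natAbs : ℂ) ^ 2
  let G' : ℕ → ℂ := fun k ↦ if inM then G k - (p : ℂ)⁻¹ * G (k + 1) else G k
  if inL then G' 0 - ((p : ℂ) ^ 2)⁻¹ * G' 1 else G' 0

lemma gcd_prime {p : ℕ} (hp : p.Prime) (w : ℤ) :
    Nat.gcd p w.natAbs = if (p : ℤ) ∣ w then p else 1 := by
  split_ifs with h
  · exact Nat.gcd_eq_left (Int.natCast_dvd.mp h)
  · exact (hp.coprime_iff_not_dvd).mpr fun h' ↦ h (Int.natCast_dvd.mpr h')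

lemma gcd_prime_sq {p : ℕ} (hp : p.Prime) (w : ℤ) :
    Nat.gcd (p ^ 2) w.natAbs =
      if (p : ℤ) ∣ w then (if (p : ℤ) ^ 2 ∣ w then p ^ 2 else p) else 1 := by
  split_ifs with h h2
  · refine Nat.gcd_eq_left (Int.natCast_dvd.mp (by exact_mod_cast h2))
  · obtain ⟨k, hk, hk'⟩ := (Nat.dvd_prime_pow hp).mp (Nat.gcd_dvd_left (p ^ 2) w.natAbs)
    have h3 : p ∣ Nat.gcd (p ^ 2) w.natAbs :=
      Nat.dvd_gcd (dvd_pow_self p two_ne_zero) (Int.natCast_dvd.mp h)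
    have h4 : k ≠ 2 := by
      rintro rfl
      exact h2 (by exact_mod_cast Int.natCast_dvd.mpr (hk' ▸ Nat.gcd_dvd_right (p ^ 2) w.natAbs))
    have h5 : k ≠ 0 := by
      rintro rfl
      rw [hk', pow_zero, Nat.dvd_one] at h3
      exact hp.one_lt.ne' h3
    rw [hk', show k = 1 by omega, pow_one]
  · exact Nat.Coprime.pow_left 2
      ((hp.coprime_iff_not_dvd).mpr fun h' ↦ h (Int.natCast_dvd.mpr h'))

lemma localFactor_eq_zero_of_not_left {p : ℕ} (hp : p.Prime) {inM inL : Prop}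
    [Decidable inM] [Decidable inL] {w : ℤ} (hM : ¬ inM) (hL : inL) (hw : (p : ℤ) ∣ w) :
    localFactor p inM inL w = 0 := by
  have : (p : ℂ) ≠ 0 := by exact_mod_cast hp.ne_zero
  simp [localFactor, hM, hL, gcd_prime hp, hw]
  field_simp
  simp

lemma localFactor_eq_zero_of_sq_dvd {p : ℕ} (hp : p.Prime) {inM inL : Prop}
    [Decidable inM] [Decidable inL] {w : ℤ} (hM : inM) (hL : inL) (hw : (p : ℤ) ^ 2 ∣ w) :
    localFactor p inM inL w = 0 := by
  have : (p : ℂ) ≠ 0 := by exact_mod_cast hp.ne_zero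
  have hw' : (p : ℤ) ∣ w := (dvd_pow_self _ two_ne_zero).trans hw
  simp [localFactor, hM, hL, gcd_prime hp, gcd_prime_sq hp, hw, hw']
  field_simp
  ring

lemma localFactor_of_only_left {p : ℕ} (hp : p.Prime) {inM inL : Prop}
    [Decidable inM] [Decidable inL] {w : ℤ} (hM : inM) (hL : ¬ inL) :
    localFactor p inM inL w = (p - 1) * if (p : ℤ) ∣ w then -1 else (p : ℂ)⁻¹ := by
  have : (p : ℂ) ≠ 0 := by exact_mod_cast hp.ne_zero
  by_cases hw : (p : ℤ) ∣ w
  · simp [localFactor, hM, hL, gcd_prime hp, hw]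
    field_simp
  · simp [localFactor, hM, hL, gcd_prime hp, hw]
    field_simp

lemma localFactor_of_only_right {p : ℕ} (hp : p.Prime) {inM inL : Prop}
    [Decidable inM] [Decidable inL] {w : ℤ} (hM : ¬ inM) (hL : inL) (hw : ¬ (p : ℤ) ∣ w) :
    localFactor p inM inL w = (p - 1) * ((p + 1) / p) * (p : ℂ)⁻¹ := by
  have : (p : ℂ) ≠ 0 := by exact_mod_cast hp.ne_zero
  simp [localFactor, hM, hL, gcd_prime hp, hw]
  field_simp
  ring

lemma localFactor_of_both {p : ℕ} (hp : p.Prime) {inM inL : Prop}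
    [Decidable inM] [Decidable inL] {w : ℤ} (hM : inM) (hL : inL) (hw : ¬ (p : ℤ) ^ 2 ∣ w) :
    localFactor p inM inL w = (p - 1) * ((p + 1) / p) *
      if (p : ℤ) ∣ w then -1 else (p : ℂ)⁻¹ * (1 - 1 / p) := by
  have : (p : ℂ) ≠ 0 := by exact_mod_cast hp.ne_zero
  by_cases hw' : (p : ℤ) ∣ w
  · simp [localFactor, hM, hL, gcd_prime hp, gcd_prime_sq hp, hw, hw']
    field_simp
    ring
  · simp [localFactor, hM, hL, gcd_prime hp, gcd_prime_sq hp, hw']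
    field_simp
    ring

end

/-! ### Constant terms of `E_{M,L,χ}` as Euler products, and the orbits of the cusps -/

section

variable {f : ℕ} [NeZero f] {χ : DirichletCharacter ℂ f}

/-- The function `E_{M,L,χ}` is holomorphic at the cusps and its constant terms are Euler
products. -/
lemma exists_hasCuspValues_EMLchi (hprim : χ.IsPrimitive) (hχ : χ ^ 2 = 1) {M L : ℕ}
    {S : Finset ℕ} (hS : ∀ p ∈ S, p.Prime ∧ Nat.Coprime p f)
    (hM : Squarefree (M / f)) (hL : Squarefree (L / f)) (hMS : (M / f).primeFactors ⊆ S)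
    (hLS : (L / f).primeFactors ⊆ S) (hM1 : f = 1 → M ≠ 1) :
    ∃ F : ℤ → ℤ → ℂ, HasCuspValues (EMLchi M L χ) 0 F ∧ ∀ u w : ℤ, IsCoprime u w →
      F u w = primitiveCuspValue χ u w * ∏ p ∈ S,
        localFactor p (p ∈ (M / f).primeFactorsList) (p ∈ (L / f).primeFactorsList) w := by
  have hpl (K : ℕ) : ∀ p ∈ K.primeFactorsList, p ≠ 0 := fun p hp ↦
    (Nat.prime_of_mem_primeFactorsList hp).ne_zero
  have hmem {K : ℕ} (hK : K.primeFactors ⊆ S) :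
      ∀ p ∈ K.primeFactorsList, p.Prime ∧ p ∈ S ∧ Nat.Coprime p f := fun p hp ↦ by
    have : p ∈ S := hK (Nat.mem_primeFactors_iff_mem_primeFactorsList.mpr hp)
    exact ⟨(hS p this).1, this, (hS p this).2⟩
  have h1 := (hasCuspValues_Echi hprim hχ).foldr (fun p ↦ χ (p : ZMod f)) (hpl (M / f))
  have h2 := h1.foldr (fun p ↦ (p : ℂ)⁻¹ * χ⁻¹ (p : ZMod f)) (hpl (L / f))
  have hκ : (∑ b : ZMod f, -(1 / (24 * gauss χ)) * χ b * (-3 / Real.pi : ℂ)) *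
      ((M / f).primeFactorsList.map fun p ↦ 1 - χ ((p : ℕ) : ZMod f)).prod = 0 := by
    by_cases hf : f = 1
    · -- one of the operators `1 - χ(p) γ_p` kills the nonholomorphic term
      have hz : ((M / f).primeFactorsList.map fun p ↦ 1 - χ ((p : ℕ) : ZMod f)).prod = 0 := by
        rw [List.prod_eq_zero_iff, List.mem_map]
        have hM1' : M / f ≠ 1 := by
          rw [hf, Nat.div_one]
          exact hM1 hf
        refine ⟨(M / f).minFac, (Nat.mem_primeFactorsList hM.ne_zero).mpr
          ⟨Nat.minFac_prime hM1', Nat.minFac_dvd _⟩, ?_⟩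
        have : (((M / f).minFac : ℕ) : ZMod f) = 1 := by
          have : Subsingleton (ZMod f) := by
            rw [hf]
            infer_instance
          exact Subsingleton.elim _ _
        rw [this, map_one, sub_self]
      rw [hz, mul_zero]
    · rw [← Finset.sum_mul, ← Finset.mul_sum, sum_char_eq_zero_of_ne_one hprim hf]
      simp
  rw [hκ, zero_mul] at h2
  refine ⟨_, h2, fun u w h ↦ ?_⟩
  have e1 := (hasEulerProduct_cuspValue hprim hχ h hS).foldr hχ (c := fun p ↦ χ (p : ZMod f))
    (τ := fun p ↦ (p : ℂ)⁻¹) (Nat.squarefree_iff_nodup_primeFactorsList hM.ne_zero |>.mp hM)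
    (hmem hMS) (fun p _ ↦ by rw [div_eq_mul_inv])
  have e2 := e1.foldr hχ (c := fun p ↦ (p : ℂ)⁻¹ * χ⁻¹ (p : ZMod f))
    (τ := fun p ↦ ((p : ℂ) ^ 2)⁻¹)
    (Nat.squarefree_iff_nodup_primeFactorsList hL.ne_zero |>.mp hL)
    (hmem hLS) (fun p _ ↦ by
      simp only [inv_eq_self_of_sq hχ]
      rw [div_eq_mul_inv, sq, mul_inv]
      ring)
  have e3 := e2 1 one_ne_zero (by simp)
  rw [Nat.cast_one, one_mul] at e3
  rw [e3]
  simp [localFactor]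

lemma prod_sub_one_eq_totient {N : ℕ} (hN : Squarefree N) :
    ∏ p ∈ N.primeFactors, ((p : ℂ) - 1) = Nat.totient N := by
  have h := Nat.totient_mul_prod_primeFactors N
  rw [Nat.prod_primeFactors_of_squarefree hN, mul_comm] at h
  rw [Nat.eq_of_mul_eq_mul_left (Nat.pos_of_ne_zero hN.ne_zero) h]
  push_cast
  exact Finset.prod_congr rfl fun p hp ↦ by
    rw [Nat.cast_sub (Nat.prime_of_mem_primeFactors hp).one_le, Nat.cast_one]

lemma prod_primeFactors_ite {M : Type*} [CommMonoid M] {n N : ℕ} (hN : N ≠ 0) (hn : n ∣ N)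
    (g : ℕ → M) :
    ∏ p ∈ N.primeFactors, (if p ∣ n then g p else 1) = ∏ p ∈ n.primeFactors, g p := by
  rw [← Finset.prod_filter, Nat.primeFactors_filter_dvd_of_dvd hN hn]

lemma prod_primeFactors_inv {n : ℕ} (hn : Squarefree n) :
    ∏ p ∈ n.primeFactors, (p : ℂ)⁻¹ = (n : ℂ)⁻¹ := by
  rw [Finset.prod_inv_distrib, ← Nat.cast_prod, Nat.prod_primeFactors_of_squarefree hn]

lemma prod_primeFactors_add_one_div {n : ℕ} (hn : Squarefree n) :
    ∏ p ∈ n.primeFactors, (((p : ℂ) + 1) / p) = psi n * (n : ℂ)⁻¹ := by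
  simp only [div_eq_mul_inv]
  rw [Finset.prod_mul_distrib, prod_primeFactors_inv hn, psi]
  push_cast
  rfl

lemma prod_primeFactors_sign {n m : ℕ} (h : Squarefree (n * m)) :
    ∏ p ∈ (n * m).primeFactors, (if p ∣ n then (p : ℂ)⁻¹ else -1) =
      (-1) ^ ArithmeticFunction.cardFactors m * (n : ℂ)⁻¹ := by
  obtain ⟨hcop, hn, hm⟩ := Nat.squarefree_mul_iff.mp h
  rw [hcop.primeFactors_mul, Finset.prod_union hcop.disjoint_primeFactors,
    Finset.prod_congr rfl fun p hp ↦ if_pos (Nat.dvd_of_mem_primeFactors hp),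
    prod_primeFactors_inv hn, mul_comm]
  congr 1
  rw [Finset.prod_congr rfl fun p hp ↦ if_neg (fun hpn ↦
    (Nat.prime_of_mem_primeFactors hp).one_lt.ne' (Nat.eq_one_of_dvd_coprimes hcop hpn
      (Nat.dvd_of_mem_primeFactors hp))), Finset.prod_const]
  congr 1
  rw [← ArithmeticFunction.cardDistinctFactors_eq_cardFactors_iff_squarefree hm.ne_zero |>.mpr hm,
    ArithmeticFunction.cardDistinctFactors_apply]
  rfl

lemma exists_prime_of_not_dvd {n m : ℕ} (hn : Squarefree n) (h : ¬ n ∣ m) :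
    ∃ p, p.Prime ∧ p ∣ n ∧ ¬ p ∣ m := by
  by_contra! hcon
  apply h
  rw [← Nat.prod_primeFactors_of_squarefree hn]
  exact Finset.prod_primes_dvd m (fun p hp ↦ (Nat.prime_of_mem_primeFactors hp).prime)
    fun p hp ↦ hcon p (Nat.prime_of_mem_primeFactors hp) (Nat.dvd_of_mem_primeFactors hp)

/-- If `γ ∞` lies in the `Γ₀(N)`-orbit of `x / W`, in lowest terms, then up to sign the first
column `(u, w)` of `γ` is carried to `(x, W)` by a matrix of `Γ₀(N)`. -/
lemma exists_Gamma0_column {N : ℕ} {γ δ : SL(2, ℤ)} (hδ : δ ∈ CongruenceSubgroup.Gamma0 N) {q : ℚ}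
    (hq : (Matrix.SpecialLinearGroup.mapGL ℚ (δ * γ)) • (∞ : OnePoint ℚ) = (q : OnePoint ℚ))
    {x W : ℤ} (hW : W ≠ 0) (hxW : IsCoprime x W) (hqx : q = x / W) :
    ∃ a b c d ε : ℤ, a * d - b * c = 1 ∧ (N : ℤ) ∣ c ∧ ε * ε = 1 ∧
      ε * x = a * γ 0 0 + b * γ 1 0 ∧ ε * W = c * γ 0 0 + d * γ 1 0 := by
  have h00 : (δ * γ) 0 0 = δ 0 0 * γ 0 0 + δ 0 1 * γ 1 0 := by
    simp [Matrix.mul_apply, Fin.sum_univ_two]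
  have h10 : (δ * γ) 1 0 = δ 1 0 * γ 0 0 + δ 1 1 * γ 1 0 := by
    simp [Matrix.mul_apply, Fin.sum_univ_two]
  have hdet (g : SL(2, ℤ)) : g 0 0 * g 1 1 - g 0 1 * g 1 0 = 1 := by
    rw [← Matrix.det_fin_two]
    exact g.2
  set U := (δ * γ) 0 0 with hU
  set V := (δ * γ) 1 0 with hV
  have hUV : IsCoprime U V := ⟨(δ * γ) 1 1, -(δ * γ) 0 1, by linarith [hdet (δ * γ)]⟩
  rw [OnePoint.smul_infty_eq_ite] at hq
  have hc : ((N : ℕ) : ℤ) ∣ δ 1 0 := by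
    rw [CongruenceSubgroup.Gamma0_mem] at hδ
    exact (ZMod.intCast_zmod_eq_zero_iff_dvd _ _).mp hδ
  have hval : V ≠ 0 ∧ (U : ℚ) / V = q := by
    have e1 : (Matrix.SpecialLinearGroup.mapGL ℚ (δ * γ)) 1 0 = (V : ℚ) := by
      rw [hV]
      generalize δ * γ = g
      simp
    have e0 : (Matrix.SpecialLinearGroup.mapGL ℚ (δ * γ)) 0 0 = (U : ℚ) := by
      rw [hU]
      generalize δ * γ = g
      simp
    rw [e1, e0] at hq
    split_ifs at hq with h0
    · exact absurd hq (OnePoint.infty_ne_coe q)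
    · exact ⟨by exact_mod_cast h0, OnePoint.coe_injective hq⟩
  obtain ⟨hV0, hUVq⟩ := hval
  have hcross : U * W = x * V := by
    have hVQ : (V : ℚ) ≠ 0 := by exact_mod_cast hV0
    have hWQ : (W : ℚ) ≠ 0 := by exact_mod_cast hW
    rw [hqx, div_eq_div_iff hVQ hWQ] at hUVq
    exact_mod_cast hUVq
  obtain ⟨ε, hε⟩ : W ∣ V := hxW.symm.dvd_of_dvd_mul_left ⟨U, by linarith⟩
  obtain ⟨ε', hε'⟩ : V ∣ W := hUV.symm.dvd_of_dvd_mul_left ⟨x, by linarith⟩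
  have hεε' : ε * ε' = 1 := by
    apply mul_left_cancel₀ hW
    rw [← mul_assoc, ← hε, ← hε', mul_one]
  have hε1 : ε * ε = 1 := by
    rcases Int.isUnit_iff.mp (IsUnit.of_mul_eq_one _ hεε') with h | h <;> rw [h] <;> norm_num
  refine ⟨δ 0 0, δ 0 1, δ 1 0, δ 1 1, ε, hdet δ, hc, hε1, ?_, ?_⟩
  · rw [← h00]
    apply mul_right_cancel₀ hW
    rw [hcross, hε]
    ring
  · rw [← h10, hε]
    ring

end

/-! ### Arithmetic of the cusps and the product of the local factors -/

section

lemma not_dvd_of_squarefree {D p x y : ℕ} (hD : Squarefree D) (hp : p.Prime) (hxy : x * y ∣ D)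
    (hx : p ∣ x) : ¬ p ∣ y := fun hy ↦
  hp.prime.not_isUnit (hD p ((mul_dvd_mul hx hy).trans hxy))

/-- For `D = s t v r r'` and `C = s t v`, the denominator of the cusp `r s² t x / (D C)` in lowest
terms is `r' t v²`; its prime divisors among those of `D` are the ones not dividing `r s`. -/
lemma prime_dvd_denom_iff {s t v r r' p : ℕ} (hD : Squarefree (s * t * v * (r * r')))
    (hp : p.Prime) (hpD : p ∣ s * t * v * (r * r')) : p ∣ r' * t * v ^ 2 ↔ ¬ p ∣ r * s := by
  constructor
  · intro h hrs
    have h1 : ¬ p ∣ r' * t * v :=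
      not_dvd_of_squarefree hD hp (dvd_of_eq (by ring)) hrs
    rcases hp.dvd_mul.mp h with h | h
    · exact h1 (h.mul_right v)
    · exact h1 ((hp.dvd_of_dvd_pow h).mul_left _)
  · intro h
    have h1 : p ∣ r * s * (r' * t * v) := hpD.trans (dvd_of_eq (by ring))
    rcases hp.dvd_mul.mp h1 with h2 | h2
    · exact absurd h2 h
    · exact h2.trans ⟨v, by ring⟩

lemma prime_sq_dvd_denom_iff {s t v r r' p : ℕ} (hD : Squarefree (s * t * v * (r * r')))
    (hp : p.Prime) (hpC : p ∣ s * t * v) : p ^ 2 ∣ r' * t * v ^ 2 ↔ ¬ p ∣ s * t := by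
  constructor
  · intro h hst
    have hr : ¬ p ∣ r' := fun h' ↦
      not_dvd_of_squarefree hD hp dvd_rfl hpC (h'.mul_left r)
    have hv : ¬ p ∣ v :=
      not_dvd_of_squarefree hD hp ⟨r * r', rfl⟩ hst
    have hcop : Nat.Coprime (p ^ 2) (r' * v ^ 2) :=
      Nat.Coprime.pow_left 2 (Nat.Coprime.mul_right ((hp.coprime_iff_not_dvd).mpr hr)
        (Nat.Coprime.pow_right 2 ((hp.coprime_iff_not_dvd).mpr hv)))
    have h1 : p ^ 2 ∣ t := hcop.dvd_of_dvd_mul_left (h.trans (dvd_of_eq (by ring)))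
    have h2 : p * p ∣ s * t * v * (r * r') := by
      rw [← sq]
      exact h1.trans ⟨s * v * (r * r'), by ring⟩
    exact hp.prime.not_isUnit (hD p h2)
  · intro h
    rcases hp.dvd_mul.mp hpC with h2 | h2
    · exact absurd h2 h
    · exact (pow_dvd_pow_of_dvd h2 2).mul_left _

lemma prime_dvd_of_dvd_both {D C M L p : ℕ} (hD : Squarefree D) (hML : M * L ∣ D * C)
    (hp : p.Prime) (hM : p ∣ M) (hL : p ∣ L) : p ∣ C := by
  by_contra h
  have h1 : p * p ∣ D * C := (mul_dvd_mul hM hL).trans hML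
  have h2 : Nat.Coprime (p * p) C :=
    Nat.Coprime.mul_left ((hp.coprime_iff_not_dvd).mpr h) ((hp.coprime_iff_not_dvd).mpr h)
  exact hp.prime.not_isUnit (hD p (h2.dvd_of_dvd_mul_right h1))

lemma mem_primeFactorsList_div_iff {f K p : ℕ} (hp : p.Prime) (hpf : ¬ p ∣ f) (hK : f ∣ K)
    (hK0 : K ≠ 0) : p ∈ (K / f).primeFactorsList ↔ p ∣ K := by
  have hf0 : 0 < f := Nat.pos_of_ne_zero (ne_zero_of_dvd_ne_zero hK0 hK)
  have hK' : K / f ≠ 0 := (Nat.div_pos (Nat.le_of_dvd (Nat.pos_of_ne_zero hK0) hK) hf0).ne'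
  rw [Nat.mem_primeFactorsList hK', and_iff_right hp]
  refine ⟨fun h ↦ h.trans (Nat.div_dvd_of_dvd hK), fun h ↦ ?_⟩
  rw [← Nat.mul_div_cancel' hK] at h
  exact (hp.dvd_mul.mp h).resolve_left hpf

/-- Congruences modulo divisors of `N` are the same for the second entries of two columns in the
same orbit of `Γ₀(N)`. -/
lemma dvd_iff_of_Gamma0_column {N : ℕ} {a b c d ε u w W m : ℤ} (hdet : a * d - b * c = 1)
    (hc : (N : ℤ) ∣ c) (hε : ε * ε = 1) (hW : ε * W = c * u + d * w) (hm : m ∣ N) :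
    m ∣ w ↔ m ∣ W := by
  have hmc : m ∣ c := hm.trans hc
  constructor
  · intro h
    have h1 : m ∣ ε * W := hW ▸ dvd_add (hmc.mul_right u) (h.mul_left d)
    have h2 : W = ε * (ε * W) := by rw [← mul_assoc, hε, one_mul]
    rw [h2]
    exact h1.mul_left ε
  · intro h
    have hcop : IsCoprime m d := by
      obtain ⟨k, hk⟩ := hmc
      exact ⟨-b * k, a, by rw [hk] at hdet; linarith⟩
    refine hcop.dvd_of_dvd_mul_left ?_
    have h1 : d * w = ε * W - c * u := by linarith
    rw [h1]
    exact dvd_sub (h.mul_left ε) (hmc.mul_right u)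

lemma not_isUnit_intCast_of_prime_dvd {f : ℕ} {n : ℤ} {p : ℕ} (hp : p.Prime) (hpf : p ∣ f)
    (hpn : (p : ℤ) ∣ n) : ¬ IsUnit (n : ZMod f) := by
  rw [ZMod.coe_int_isUnit_iff_isCoprime]
  intro h
  have h1 := h.isUnit_of_dvd' (Int.natCast_dvd_natCast.mpr hpf) hpn
  exact hp.prime.not_isUnit (Int.ofNat_isUnit.mp h1)

variable {f : ℕ} {χ : DirichletCharacter ℂ f}

/-- The character value `χ(u) χ(w / f)` is constant on orbits of `Γ₀(N)` when `f² ∣ N`, because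
the diagonal entries of such a matrix are inverse to each other modulo `f`. -/
lemma char_mul_char_of_Gamma0_column (hf : f ≠ 0) {N : ℕ}
    {a b c d ε u w x W : ℤ} (hdet : a * d - b * c = 1)
    (hc : (N : ℤ) ∣ c) (hε : ε * ε = 1) (hx : ε * x = a * u + b * (f * w))
    (hW : ε * (f * W) = c * u + d * (f * w)) (hN : f * f ∣ N) :
    χ (u : ZMod f) * χ (w : ZMod f) = χ (x : ZMod f) * χ (W : ZMod f) := by
  have hf' : (f : ℤ) ≠ 0 := by exact_mod_cast hf
  obtain ⟨k, hk⟩ : (f : ℤ) * f ∣ c := (by exact_mod_cast hN : (f : ℤ) * f ∣ N).trans hc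
  have hW' : ε * W = f * k * u + d * w := by
    apply mul_left_cancel₀ hf'
    rw [hk] at hW
    linarith
  have e1 : χ (ε : ZMod f) * χ (x : ZMod f) = χ (a : ZMod f) * χ (u : ZMod f) := by
    rw [← map_mul, ← map_mul]
    congr 1
    have := congrArg (fun n : ℤ ↦ (n : ZMod f)) hx
    simpa using this
  have e2 : χ (ε : ZMod f) * χ (W : ZMod f) = χ (d : ZMod f) * χ (w : ZMod f) := by
    rw [← map_mul, ← map_mul]
    congr 1
    have := congrArg (fun n : ℤ ↦ (n : ZMod f)) hW'
    simpa using this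
  have e3 : χ (a : ZMod f) * χ (d : ZMod f) = 1 := by
    rw [← map_mul, ← map_one χ]
    congr 1
    have := congrArg (fun n : ℤ ↦ (n : ZMod f)) hdet
    rw [hk] at this
    simpa using this
  have e4 : χ (ε : ZMod f) * χ (ε : ZMod f) = 1 := by
    rw [← map_mul, ← Int.cast_mul, hε, Int.cast_one, map_one]
  calc χ (u : ZMod f) * χ (w : ZMod f)
      = (χ (a : ZMod f) * χ (u : ZMod f)) * (χ (d : ZMod f) * χ (w : ZMod f)) := by
        linear_combination (-χ (u : ZMod f) * χ (w : ZMod f)) * e3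
    _ = _ := by
        rw [← e1, ← e2]
        linear_combination (χ (x : ZMod f) * χ (W : ZMod f)) * e4

/-- At the cusps where no local factor vanishes, their product in closed form. -/
lemma prod_localFactor {D C M L r s t : ℕ} {w : ℤ} (hf : f ≠ 0) (hD : Squarefree D)
    (hL : L ∣ D) (hfM : f ∣ M) (hfL : f ∣ L) (hDML : D ∣ M * L)
    (hML : M * L ∣ D * C) (hrs : f * (r * s) ∣ D)
    (hrC : Nat.Coprime r C)
    (hst : Nat.gcd M L ∣ s * t) (hDM : D / M ∣ r * s) (hM : M ∣ D)
    (hw1 : ∀ p : ℕ, p.Prime → p ∣ D → ((p : ℤ) ∣ w ↔ ¬ p ∣ r * s))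
    (hw2 : ∀ p : ℕ, p.Prime → p ∣ C → ((p : ℤ) ^ 2 ∣ w ↔ ¬ p ∣ s * t)) :
    ∏ p ∈ (D / f).primeFactors,
      localFactor p (p ∈ (M / f).primeFactorsList) (p ∈ (L / f).primeFactorsList) w =
      Nat.totient (D / f) * psi (L / f) * ((f : ℂ) / L) *
        ((-1) ^ ArithmeticFunction.cardFactors (D / (f * r * s)) * ((r : ℂ) * s)⁻¹ *
          ∏ p ∈ (Nat.gcd s (Nat.gcd M L)).primeFactors, (1 - 1 / (p : ℂ))) := by
  have hfD : f ∣ D := (dvd_mul_right f (r * s)).trans hrs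
  have hDN : f * (D / f) = D := Nat.mul_div_cancel' hfD
  have hNsq : Squarefree (D / f) := hD.squarefree_of_dvd (Nat.div_dvd_of_dvd hfD)
  have hfN : Nat.Coprime f (D / f) := by
    rw [← hDN] at hD
    exact (Nat.squarefree_mul_iff.mp hD).1
  obtain ⟨m, hm⟩ : r * s ∣ D / f := Nat.dvd_div_of_mul_dvd hrs
  have hrs0 : r * s ≠ 0 := fun h ↦ hNsq.ne_zero (by rw [hm, h, zero_mul])
  have hm' : D / (f * r * s) = m := by
    rw [mul_assoc, ← Nat.div_div_eq_div_mul, hm, Nat.mul_div_cancel_left _ (Nat.pos_of_ne_zero hrs0)]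
  have hLf : L / f ∣ D / f := Nat.div_dvd_div hfL hL
  have hLfsq : Squarefree (L / f) := hNsq.squarefree_of_dvd hLf
  have hgD : Nat.gcd s (Nat.gcd M L) ∣ D / f := by
    have h1 : Nat.gcd s (Nat.gcd M L) ∣ r * s := (Nat.gcd_dvd_left _ _).mul_left r
    exact h1.trans ⟨m, hm⟩
  have hL0 : L ≠ 0 := fun h ↦ hD.ne_zero (by simpa [h] using hL)
  have hM0 : M ≠ 0 := fun h ↦ hD.ne_zero (by simpa [h] using hM)
  have hloc : ∀ p ∈ (D / f).primeFactors,
      localFactor p (p ∈ (M / f).primeFactorsList) (p ∈ (L / f).primeFactorsList) w =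
        ((p : ℂ) - 1) * (if p ∣ L / f then ((p : ℂ) + 1) / p else 1) *
        (if p ∣ r * s then (p : ℂ)⁻¹ else -1) *
        (if p ∣ Nat.gcd s (Nat.gcd M L) then 1 - 1 / (p : ℂ) else 1) := by
    intro p hp
    have hpp := Nat.prime_of_mem_primeFactors hp
    have hpN := Nat.dvd_of_mem_primeFactors hp
    have hpD : p ∣ D := hpN.trans (Nat.div_dvd_of_dvd hfD)
    have hpf : ¬ p ∣ f := fun h ↦ hpp.one_lt.ne' (Nat.eq_one_of_dvd_coprimes hfN h hpN)
    have hML' : p ∣ M ∨ p ∣ L := hpp.dvd_mul.mp (hpD.trans hDML)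
    have hiM := mem_primeFactorsList_div_iff hpp hpf hfM hM0
    have hiL := mem_primeFactorsList_div_iff hpp hpf hfL hL0
    have hiL' : p ∣ L / f ↔ p ∣ L := by
      rw [← hiL, Nat.mem_primeFactorsList hLfsq.ne_zero, and_iff_right hpp]
    have hw := hw1 p hpp hpD
    have hg : p ∣ Nat.gcd s (Nat.gcd M L) ↔ p ∣ s ∧ p ∣ M ∧ p ∣ L := by
      rw [Nat.dvd_gcd_iff, Nat.dvd_gcd_iff]
    by_cases hpM : p ∣ M
    · by_cases hpL : p ∣ L
      · have hpC := prime_dvd_of_dvd_both hD hML hpp hpM hpL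
        have hpst : p ∣ s * t := (Nat.dvd_gcd hpM hpL).trans hst
        rw [localFactor_of_both hpp (hiM.mpr hpM) (hiL.mpr hpL)
          (fun h ↦ (hw2 p hpp hpC).mp h hpst)]
        have hpr : ¬ p ∣ r := fun h ↦
          hpp.one_lt.ne' (Nat.eq_one_of_dvd_coprimes hrC h hpC)
        have hprs : p ∣ r * s ↔ p ∣ s :=
          ⟨fun h ↦ (hpp.dvd_mul.mp h).resolve_left hpr, fun h ↦ h.mul_left r⟩
        by_cases hps : p ∣ s
        · simp [hw, hprs, hps, hg, hiL', hpM, hpL, mul_assoc]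
        · simp [hw, hprs, hps, hg, hiL', hpM, hpL]
      · rw [localFactor_of_only_left hpp (hiM.mpr hpM) (fun h ↦ hpL (hiL.mp h))]
        by_cases hprs : p ∣ r * s <;> simp [hw, hprs, hg, hiL', hpL]
    · have hpL := hML'.resolve_left hpM
      have hprs : p ∣ r * s := by
        refine dvd_trans ?_ hDM
        rw [← Nat.mul_div_cancel' hM] at hpD
        exact (hpp.dvd_mul.mp hpD).resolve_left hpM
      rw [localFactor_of_only_right hpp (fun h ↦ hpM (hiM.mp h)) (hiL.mpr hpL)
        (fun h ↦ hw.mp h hprs)]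
      simp [hprs, hg, hiL', hpM, hpL]
  rw [Finset.prod_congr rfl hloc, Finset.prod_mul_distrib, Finset.prod_mul_distrib,
    Finset.prod_mul_distrib, prod_sub_one_eq_totient hNsq,
    prod_primeFactors_ite hNsq.ne_zero hLf, prod_primeFactors_ite hNsq.ne_zero hgD,
    prod_primeFactors_add_one_div hLfsq, hm']
  have hsign := prod_primeFactors_sign (n := r * s) (m := m) (hm ▸ hNsq)
  rw [← hm] at hsign
  rw [hsign, Nat.cast_div hfL (by exact_mod_cast hf), inv_div, Nat.cast_mul]
  ring

end

end

end EisConst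

/-! ### The constant terms -/

theorem proposition4p6 (D C : ℕ) (hD : Squarefree D) (hC : C ∣ D)
    (M L f : ℕ) [NeZero f] (χ : DirichletCharacter ℂ f)
    (hH : EisConst.MemH D C M L χ) (hχ : χ ^ 2 = 1)
    (r s t : ℕ) (x : ℤ) (hr : r ∣ D / C) (hs : s ∣ C) (ht : t ∣ C)
    (hst : Nat.Coprime s t) (hx : IsCoprime x (D : ℤ)) :
    EisConst.HasConstantTermAt (D * C) (EisConst.EMLchi M L χ)
      ((r : ℚ) * (s : ℚ) ^ 2 * (t : ℚ) * (x : ℚ) / ((D : ℚ) * (C : ℚ)))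
      (if Nat.Coprime s f ∧ Nat.gcd M L ∣ s * t ∧ D / M ∣ r * s then
        EisConst.nchi χ * (Nat.totient (D / f) : ℂ) * (EisConst.psi (L / f) : ℂ) *
          ((f : ℂ) / (L : ℂ)) * EisConst.cchi D C M L χ r s t x
      else 0) := by
  open EisConst in
  obtain ⟨hMD, hLD, hM1, hDML, hMLDC, hprim, hfg⟩ := hH
  have hf0 : f ≠ 0 := NeZero.ne f
  have hfM : f ∣ M := hfg.trans (Nat.gcd_dvd_left _ _)
  have hfL : f ∣ L := hfg.trans (Nat.gcd_dvd_right _ _)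
  have hfD : f ∣ D := hfM.trans hMD
  have hfsq : Squarefree f := hD.squarefree_of_dvd hfD
  have hfC : f ∣ C := by
    by_contra h
    obtain ⟨p, hp, hpf, hpC⟩ := exists_prime_of_not_dvd hfsq h
    exact hpC (prime_dvd_of_dvd_both hD hMLDC hp (hpf.trans hfM) (hpf.trans hfL))
  obtain ⟨v, hv⟩ : s * t ∣ C := hst.mul_dvd_of_dvd_of_dvd hs ht
  obtain ⟨r', hr'⟩ := hr
  have hDeq : s * t * v * (r * r') = D := by
    rw [← hv, ← hr', Nat.mul_div_cancel' hC]
  have hDsq : Squarefree (s * t * v * (r * r')) := hDeq ▸ hD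
  have hDC : D * C = r * s ^ 2 * t * (r' * t * v ^ 2) := by
    rw [← hDeq, hv]
    ring
  obtain ⟨W, hW⟩ : ∃ W, W = r' * t * v ^ 2 := ⟨_, rfl⟩
  have hD0 : D * C ≠ 0 := mul_ne_zero hD.ne_zero (ne_zero_of_dvd_ne_zero hD.ne_zero hC)
  rw [← hW] at hDC
  have hW0 : W ≠ 0 := fun h ↦ hD0 (by rw [hDC, h, mul_zero])
  have hxW : IsCoprime x (W : ℤ) := by
    have h1 : W ∣ D ^ 2 := (Dvd.intro_left _ hDC.symm).trans
      (by rw [sq]; exact mul_dvd_mul_left D hC)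
    exact (hx.pow_right (n := 2)).of_isCoprime_of_dvd_right (by exact_mod_cast h1)
  have hq : (r : ℚ) * (s : ℚ) ^ 2 * (t : ℚ) * (x : ℚ) / ((D : ℚ) * (C : ℚ)) =
      (x : ℚ) / ((W : ℤ) : ℚ) := by
    have h1 : (D : ℚ) * C = r * s ^ 2 * t * W := by exact_mod_cast hDC
    have h2 : (r * s ^ 2 * t * W : ℚ) ≠ 0 := by
      rw [← h1]
      exact_mod_cast hD0
    have h3 : (W : ℚ) ≠ 0 := by exact_mod_cast hW0
    have h4 : (r * s ^ 2 * t : ℚ) ≠ 0 := left_ne_zero_of_mul h2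
    rw [h1, Int.cast_natCast, div_eq_div_iff h2 h3]
    ring
  rintro γ ⟨δ, hδ, hδq⟩
  obtain ⟨a, b, c, d, ε, hdet, hc, hε, hxu, hWw⟩ :=
    exists_Gamma0_column hδ hδq (by exact_mod_cast hW0) hxW hq
  have hγdet : γ 0 0 * γ 1 1 - γ 0 1 * γ 1 0 = 1 := by
    rw [← Matrix.det_fin_two]
    exact γ.2
  have hNf : Squarefree (D / f) := hD.squarefree_of_dvd (Nat.div_dvd_of_dvd hfD)
  have hfN : Nat.Coprime f (D / f) := by
    rw [← Nat.mul_div_cancel' hfD] at hD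
    exact (Nat.squarefree_mul_iff.mp hD).1
  have hMf : M / f ∣ D / f := Nat.div_dvd_div hfM hMD
  have hLf : L / f ∣ D / f := Nat.div_dvd_div hfL hLD
  obtain ⟨F, hF, hFv⟩ := exists_hasCuspValues_EMLchi hprim hχ (M := M) (L := L)
    (S := (D / f).primeFactors)
    (fun p hp ↦ ⟨Nat.prime_of_mem_primeFactors hp,
      (hfN.coprime_dvd_right (Nat.dvd_of_mem_primeFactors hp)).symm⟩)
    (hNf.squarefree_of_dvd hMf) (hNf.squarefree_of_dvd hLf)
    (Nat.primeFactors_mono hMf hNf.ne_zero) (Nat.primeFactors_mono hLf hNf.ne_zero)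
    (fun _ ↦ hM1)
  have hser := hF (γ : GL (Fin 2) ℝ) γ.1 (by ext i j; simp) (by rw [γ.2]; exact one_pos)
  rw [γ.2, Int.cast_one, div_one, hFv _ _ ⟨γ 1 1, -γ 0 1, by linarith⟩] at hser
  obtain ⟨u, hu⟩ : ∃ u, u = γ 0 0 := ⟨_, rfl⟩
  obtain ⟨w, hw⟩ : ∃ w, w = γ 1 0 := ⟨_, rfl⟩
  rw [← hu, ← hw] at hser hxu hWw
  have hdvd (m : ℕ) (hm : m ∣ D * C) : (m : ℤ) ∣ w ↔ m ∣ W := by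
    rw [dvd_iff_of_Gamma0_column hdet hc hε hWw (by exact_mod_cast hm)]
    exact Int.natCast_dvd_natCast
  have hw1 : ∀ p : ℕ, p.Prime → p ∣ D → ((p : ℤ) ∣ w ↔ ¬ p ∣ r * s) := fun p hp hpD ↦ by
    rw [hdvd p (hpD.mul_right C), hW]
    exact prime_dvd_denom_iff hDsq hp (hDeq ▸ hpD)
  have hw2 : ∀ p : ℕ, p.Prime → p ∣ C → ((p : ℤ) ^ 2 ∣ w ↔ ¬ p ∣ s * t) := fun p hp hpC ↦ by
    have h1 := hdvd (p ^ 2) (by rw [sq]; exact mul_dvd_mul (hpC.trans hC) hpC)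
    rw [← Nat.cast_pow, h1, hW]
    exact prime_sq_dvd_denom_iff hDsq hp (hv ▸ hpC)
  have hval : primitiveCuspValue χ u w * ∏ p ∈ (D / f).primeFactors,
      localFactor p (p ∈ (M / f).primeFactorsList) (p ∈ (L / f).primeFactorsList) w =
      if Nat.Coprime s f ∧ Nat.gcd M L ∣ s * t ∧ D / M ∣ r * s then
        nchi χ * (Nat.totient (D / f) : ℂ) * (psi (L / f) : ℂ) *
          ((f : ℂ) / (L : ℂ)) * cchi D C M L χ r s t x
      else 0 := by
    have hM0 : M ≠ 0 := ne_zero_of_dvd_ne_zero hD.ne_zero hMD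
    have hL0 : L ≠ 0 := ne_zero_of_dvd_ne_zero hD.ne_zero hLD
    have hmemS {p : ℕ} (hp : p.Prime) (hpf : ¬ p ∣ f) (hpD : p ∣ D) :
        p ∈ (D / f).primeFactors :=
      Nat.mem_primeFactors_iff_mem_primeFactorsList.mpr
        ((mem_primeFactorsList_div_iff hp hpf hfD hD.ne_zero).mpr hpD)
    split_ifs with hgood
    · obtain ⟨hsf, hgst, hDM⟩ := hgood
      have hft : f ∣ t := hsf.symm.dvd_of_dvd_mul_left (hfg.trans hgst)
      have hfW : f ∣ W := hW ▸ (hft.mul_left r').mul_right _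
      have hfw : (f : ℤ) ∣ w := (hdvd f (hfD.mul_right C)).mpr hfW
      obtain ⟨w', rfl⟩ := hfw
      obtain ⟨W', rfl⟩ := hfW
      have hfz : (f : ℤ) ≠ 0 := by exact_mod_cast hf0
      have hchar := char_mul_char_of_Gamma0_column (χ := χ) (W := W') hf0 hdet hc hε hxu
        (by exact_mod_cast hWw) (mul_dvd_mul hfD hfC)
      have hrC : Nat.Coprime r C := by
        refine Nat.coprime_of_dvd fun p hp hpr hpC ↦ ?_
        exact not_dvd_of_squarefree hDsq hp dvd_rfl (hv ▸ hpC) (hpr.mul_right r')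
      have hrs : f * (r * s) ∣ D := by
        rw [← hDeq]
        obtain ⟨t', rfl⟩ := hft
        exact ⟨t' * v * r', by ring⟩
      rw [primitiveCuspValue, if_pos (dvd_mul_right _ _), Int.mul_ediv_cancel_left _ hfz, hchar,
        prod_localFactor hf0 hD hLD hfM hfL hDML hMLDC hrs hrC hgst hDM hMD hw1 hw2, cchi]
      have hW' : D * C / (f * r * s ^ 2 * t) = W' := by
        have h1 : D * C = f * r * s ^ 2 * t * W' := by rw [hDC]; ring
        have h2 : f * r * s ^ 2 * t ≠ 0 := fun h ↦ hD0 (by rw [h1, h, zero_mul])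
        rw [h1, Nat.mul_div_cancel_left _ (Nat.pos_of_ne_zero h2)]
      have hxu : IsUnit (x : ZMod f) := (ZMod.coe_int_isUnit_iff_isCoprime x f).mpr
        (hx.of_isCoprime_of_dvd_right (Int.natCast_dvd_natCast.mpr hfD)).symm
      rw [hW', inv_eq_of_mul_eq_one_left (char_mul_self_of_isUnit hχ hxu), Int.cast_natCast]
      ring
    · by_cases hsf : Nat.Coprime s f
      · by_cases hgst : Nat.gcd M L ∣ s * t
        · have hDM : ¬ D / M ∣ r * s := fun h ↦ hgood ⟨hsf, hgst, h⟩
          have hDM' : M * (D / M) = D := Nat.mul_div_cancel' hMD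
          obtain ⟨p, hp, hpDM, hprs⟩ := exists_prime_of_not_dvd
            (hD.squarefree_of_dvd (Nat.div_dvd_of_dvd hMD)) hDM
          have hpD : p ∣ D := hpDM.trans (Nat.div_dvd_of_dvd hMD)
          have hpM : ¬ p ∣ M := fun h ↦
            not_dvd_of_squarefree hD hp (dvd_of_eq hDM') h hpDM
          have hpL : p ∣ L := (hp.dvd_mul.mp (hpD.trans hDML)).resolve_left hpM
          have hpf : ¬ p ∣ f := fun h ↦ hpM (h.trans hfM)
          refine mul_eq_zero_of_right _ (Finset.prod_eq_zero (hmemS hp hpf hpD) ?_)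
          exact localFactor_eq_zero_of_not_left hp
            (fun h ↦ hpM ((mem_primeFactorsList_div_iff hp hpf hfM hM0).mp h))
            ((mem_primeFactorsList_div_iff hp hpf hfL hL0).mpr hpL) ((hw1 p hp hpD).mpr hprs)
        · obtain ⟨p, hp, hpg, hpst⟩ := exists_prime_of_not_dvd
            (hD.squarefree_of_dvd ((Nat.gcd_dvd_left M L).trans hMD)) hgst
          have hpM : p ∣ M := hpg.trans (Nat.gcd_dvd_left _ _)
          have hpL : p ∣ L := hpg.trans (Nat.gcd_dvd_right _ _)
          have hpw := (hw2 p hp (prime_dvd_of_dvd_both hD hMLDC hp hpM hpL)).mpr hpst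
          by_cases hpf : p ∣ f
          · -- here `p` still divides `w / f`, so that the character vanishes
            refine mul_eq_zero_of_left ?_ _
            rw [primitiveCuspValue]
            split_ifs with hfw
            · obtain ⟨w', rfl⟩ := hfw
              have hpw' : (p : ℤ) ∣ w' := by
                by_contra hpw'
                have hcop : IsCoprime ((p : ℤ) ^ 2) w' := by
                  refine IsCoprime.pow_left ?_
                  exact (Nat.prime_iff_prime_int.mp hp).coprime_iff_not_dvd.mpr hpw'
                have h1 : p * p ∣ f := by
                  have := hcop.dvd_of_dvd_mul_right hpw
                  rw [← sq]
                  exact_mod_cast this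
                exact hp.prime.not_isUnit (hfsq p h1)
              rw [Int.mul_ediv_cancel_left _ (by exact_mod_cast hf0),
                χ.map_nonunit (not_isUnit_intCast_of_prime_dvd hp hpf hpw'), mul_zero, mul_zero]
            · rw [mul_zero]
          · refine mul_eq_zero_of_right _ (Finset.prod_eq_zero (hmemS hp hpf (hpM.trans hMD)) ?_)
            exact localFactor_eq_zero_of_sq_dvd hp
              ((mem_primeFactorsList_div_iff hp hpf hfM hM0).mpr hpM)
              ((mem_primeFactorsList_div_iff hp hpf hfL hL0).mpr hpL) hpw
      · -- a common prime factor of `s` and `f` does not divide `w`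
        refine mul_eq_zero_of_left ?_ _
        obtain ⟨p, hp, hps, hpf⟩ := Nat.Prime.not_coprime_iff_dvd.mp hsf
        rw [primitiveCuspValue, if_neg, mul_zero]
        intro hfw
        have hpw : (p : ℤ) ∣ w := (Int.natCast_dvd_natCast.mpr hpf).trans hfw
        exact (hw1 p hp (hpf.trans hfD)).mp hpw (hps.mul_left r)
  rw [hval] at hser
  obtain ⟨h, hh, A, hA, hsum⟩ := hser
  refine ⟨h, hh, A, hA, fun z ↦ ?_⟩
  simpa [ModularForm.SL_slash] using hsum z
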